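/- Let $R$ be a reduced irreducible (crystallographic) root system in a real vector space $V$, with hyperplanes $H_{\alpha,k}=\{x\in V:\langle x,\alpha^\vee\rangle=k\}$ ($\alpha\in R$, $k\in\mathbb Z$) and affine Weyl group generated by the reflections at these hyperplanes. Let $X$ be a thick affine building of type $R$ with a system of apartments in which any two Weyl chambers contain sub-Weyl chambers lying in a common apartment. Fix an apartment $A$ of $X$, a special vertex $0$ of $A$ and a fundamental Weyl chamber $\mathcal C_f$ of $A$ with vertex $0$; let $\mathcal C_{-f}$ be the Weyl chamber with vertex $0$ opposite to $\mathcal C_f$ in $A$. Let $\rho:X\to A$ be the retraction centered at the parallel class $\partial\mathcal C_{-f}$, i.e. the distance non-increasing map whose restriction to every apartment $B$ containing a sub-Weyl chamber of $\mathcal C_{-f}$ is an isomorphism onto $A$ fixing $A\cap B$ pointwise. A gallery is a sequence $\gamma=(c_0',c_0,c_1',c_1,\dots,c_n',c_n,c_{n+1}')$ in which the $c_i$ are alcoves, the source $c_0'$ is a vertex of $c_0$, the target $c_{n+1}'$ is a vertex of $c_n$, and $c_i'$ is a codimension one face of both $c_{i-1}$ and $c_i$ for $1\le i\le n$. Its type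 is the list of the types of $c_0',c_1',\dots,c_{n+1}'$. It is minimal if no gallery in $X$ with the same source and the same target has smaller length $n$. A gallery contained in $A$ is positively folded if, whenever $c_i=c_{i-1}$, the hyperplane $H$ of $A$ spanned by $c_i'$ separates $c_i$ from $\mathcal C_{-f}$, i.e. $c_i$ and some translate of $\mathcal C_{-f}$ in $A$ lie in different half-apartments determined by $H$. Let $t$ be the type of some minimal gallery in $X$ with source $0$, and let $\gamma\subset A$ be a positively folded gallery of type $t$ with source $0$. Then $\gamma$ has a pre-image under $\rho$ which is a minimal gallery starting at $0$: there is a minimal gallery $\sigma$ in $X$ of type $t$ with source $0$ such that $\rho(\sigma)=\gamma$ (term by term). -/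

import Mathlib

/-! Throughout, `R` is a root system in the real vector space `V`. The roots are the vectors
`R.root i ∈ V`, and `R.coroot' i : V → ℝ` is the linear form `⟨·, αᵢ^∨⟩`. Since `-αᵢ` is again a
root, the half spaces `⟨x, αᵢ^∨⟩ ≤ k` are among the half spaces `l ≤ ⟨x, αⱼ^∨⟩`. -/

namespace RootPairing

variable {ι V N : Type*} [AddCommGroup V] [Module ℝ V] [AddCommGroup N] [Module ℝ N]
  (R : RootPairing ι ℝ V N)

/-- The hyperplane `H_{α,k} = {x | ⟨x, α^∨⟩ = k}`, where `α` is the `i`-th root. -/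
def affineHyperplane (i : ι) (k : ℤ) : Set V := {x | R.coroot' i x = k}

/-- The half apartment `{x | k ≤ ⟨x, α^∨⟩}`. -/
def upperHalf (i : ι) (k : ℤ) : Set V := {x | (k : ℝ) ≤ R.coroot' i x}

/-- The half apartment `{x | ⟨x, α^∨⟩ ≤ k}`. -/
def lowerHalf (i : ι) (k : ℤ) : Set V := {x | R.coroot' i x ≤ k}

/-- The affine reflection `x ↦ x - ⟨x, α^∨⟩ α + k α` at the hyperplane `H_{α,k}`. -/
noncomputable def affineReflection (i : ι) (k : ℤ) : V ≃ᵃ[ℝ] V :=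
  (R.reflection i).toAffineEquiv.trans (AffineEquiv.constVAdd ℝ V ((k : ℝ) • R.root i))

/-- The affine Weyl group, generated by the reflections at all hyperplanes `H_{α,k}`. -/
def affineWeylGroup : Subgroup (V ≃ᵃ[ℝ] V) :=
  Subgroup.closure {w | ∃ (i : ι) (k : ℤ), w = R.affineReflection i k}

/-- A set is `W`-convex if it is an intersection of finitely many half apartments. -/
def IsWConvex (C : Set V) : Prop :=
  ∃ s : Finset (ι × ℤ), C = ⋂ p ∈ s, R.upperHalf p.1 p.2

/-- The closed face of the hyperplane arrangement that contains `v` in its relative interior: the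
intersection of all half apartments containing `v`. -/
def closedFace (v : V) : Set V :=
  {u | ∀ (i : ι) (k : ℤ), v ∈ R.upperHalf i k → u ∈ R.upperHalf i k}

/-- The point `v` lies on no hyperplane. Then `closedFace v` is the closure of the connected
component of `v` in the complement of the hyperplanes. -/
def IsRegularPoint (v : V) : Prop := ∀ (i : ι) (k : ℤ), v ∉ R.affineHyperplane i k

/-- Alcoves: closures of the connected components of the complement of all hyperplanes. -/
def IsAlcove (c : Set V) : Prop := ∃ v, R.IsRegularPoint v ∧ c = R.closedFace v

/-- Panels: faces of codimension one, that is, faces whose relative interior meets exactly one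
hyperplane (note that `H_{α,k} = H_{-α,-k}` is counted once). -/
def IsPanel (p : Set V) : Prop :=
  ∃ v, (∃! H : Set V, (∃ (i : ι) (k : ℤ), H = R.affineHyperplane i k) ∧ v ∈ H) ∧
    p = R.closedFace v

/-- Vertices: points that are faces by themselves. -/
def IsVertex (v : V) : Prop := R.closedFace v = {v}

/-- Special points: for each root `α` some hyperplane `H_{α,k}` contains the point. -/
def IsSpecial (v : V) : Prop := ∀ i : ι, ∃ k : ℤ, v ∈ R.affineHyperplane i k

variable {R} in
/-- The Weyl chamber with vertex `v` in the direction of the fundamental chamber of the root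
basis `b`. -/
def weylChamber (b : R.Base) (v : V) : Set V := {x | ∀ i ∈ b.support, 0 ≤ R.coroot' i (x - v)}

variable {R} in
/-- The Weyl chamber with vertex `v` opposite to `weylChamber b v`. -/
def oppWeylChamber (b : R.Base) (v : V) : Set V := {x | ∀ i ∈ b.support, R.coroot' i (x - v) ≤ 0}

/-- The hyperplane `H_{α,k}` separates `D` and (the parallel class of) the Weyl chamber `S`: some
translate of `S` and `D` lie in different half apartments determined by `H_{α,k}`. -/
def Separates (i : ι) (k : ℤ) (D S : Set V) : Prop :=
  ∃ v : V, ((fun x => v + x) '' S ⊆ R.upperHalf i k ∧ D ⊆ R.lowerHalf i k) ∨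
    ((fun x => v + x) '' S ⊆ R.lowerHalf i k ∧ D ⊆ R.upperHalf i k)

/-- The Euclidean distance on `V` coming from the canonical Weyl group invariant inner product. -/
noncomputable def weylDist [Fintype ι] (u v : V) : ℝ := √(R.RootForm (u - v) (u - v))

end RootPairing

/-- A (simplicial) affine building of type `R` with its system of apartments, given as a set of
points `X` (the geometric realization) with an atlas of type preserving charts `V → X`. The
apartments are the ranges of the charts, and alcoves, faces and vertices of `X` are the images of
those of `V`. -/
structure AffineBuilding {ι V N : Type*} [AddCommGroup V] [Module ℝ V] [AddCommGroup N]
    [Module ℝ N] (R : RootPairing ι ℝ V N) (X : Type*) where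
  /-- The charts. -/
  charts : Set (V → X)
  injective : ∀ f ∈ charts, Function.Injective f
  /-- The atlas is closed under precomposition with the affine Weyl group. -/
  comp_mem : ∀ f ∈ charts, ∀ w ∈ R.affineWeylGroup, f ∘ w ∈ charts
  /-- Two apartments meet in a `W`-convex set. -/
  convex : ∀ f ∈ charts, ∀ g ∈ charts, R.IsWConvex (f ⁻¹' Set.range g)
  /-- Coordinate changes are restrictions of elements of the affine Weyl group. -/
  transition : ∀ f ∈ charts, ∀ g ∈ charts, ∃ w ∈ R.affineWeylGroup,
    ∀ v ∈ f ⁻¹' Set.range g, f v = g (w v)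
  /-- Any two points lie in a common apartment. -/
  common : ∀ x y : X, ∃ f ∈ charts, x ∈ Set.range f ∧ y ∈ Set.range f
  /-- Any two Weyl chambers contain sub-Weyl chambers lying in a common apartment. -/
  sectors : ∀ f ∈ charts, ∀ g ∈ charts, ∀ (b b' : R.Base) (u v : V),
    ∃ h ∈ charts, ∃ u' v' : V,
      RootPairing.weylChamber b u' ⊆ RootPairing.weylChamber b u ∧
      RootPairing.weylChamber b' v' ⊆ RootPairing.weylChamber b' v ∧
      f '' RootPairing.weylChamber b u' ⊆ Set.range h ∧
      g '' RootPairing.weylChamber b' v' ⊆ Set.range h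

namespace AffineBuilding

variable {ι V N X : Type*} [AddCommGroup V] [Module ℝ V] [AddCommGroup N] [Module ℝ N]
  {R : RootPairing ι ℝ V N} (B : AffineBuilding R X)

/-- Alcoves of the building. -/
def IsAlcove (c : Set X) : Prop := ∃ f ∈ B.charts, ∃ D, R.IsAlcove D ∧ c = f '' D

/-- Panels (codimension one faces) of the building. -/
def IsPanel (p : Set X) : Prop := ∃ f ∈ B.charts, ∃ F, R.IsPanel F ∧ p = f '' F

/-- Vertices of the building. -/
def IsVertex (x : X) : Prop := ∃ f ∈ B.charts, ∃ v, R.IsVertex v ∧ x = f v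

/-- The building is thick: every panel is contained in at least three alcoves. -/
def IsThick : Prop := ∀ p, B.IsPanel p → 3 ≤ {c | B.IsAlcove c ∧ p ⊆ c}.encard

/-- The type of a face `F` of the building: the orbit under the affine Weyl group of the faces of
`V` which are mapped to `F` by charts. -/
def faceType (F : Set X) : Set (Set V) := {D | ∃ f ∈ B.charts, f '' D = F}

/-- A combinatorial gallery `(c₀', c₀, c₁', c₁, …, cₙ', cₙ, cₙ₊₁')`. Here `alcove i = cᵢ` and
`panel i = cᵢ₊₁'`, the panel between `cᵢ` and `cᵢ₊₁`. -/
structure Gallery (n : ℕ) where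
  source : X
  target : X
  alcove : Fin (n + 1) → Set X
  panel : Fin n → Set X
  isVertex_source : B.IsVertex source
  isVertex_target : B.IsVertex target
  isAlcove : ∀ i, B.IsAlcove (alcove i)
  isPanel : ∀ i, B.IsPanel (panel i)
  source_mem : source ∈ alcove 0
  target_mem : target ∈ alcove (Fin.last n)
  panel_subset_left : ∀ i : Fin n, panel i ⊆ alcove i.castSucc
  panel_subset_right : ∀ i : Fin n, panel i ⊆ alcove i.succ

namespace Gallery

variable {B} {n : ℕ}

/-- The type of a gallery: the types of its source, of its panels, and of its target. -/
def type (γ : B.Gallery n) : Set (Set V) × (Fin n → Set (Set V)) × Set (Set V) :=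
  (B.faceType {γ.source}, fun i => B.faceType (γ.panel i), B.faceType {γ.target})

/-- A gallery is minimal if it is a shortest gallery in the building from its source to its
target. -/
def IsMinimal (γ : B.Gallery n) : Prop :=
  ∀ (m : ℕ) (σ : B.Gallery m), σ.source = γ.source → σ.target = γ.target → n ≤ m

/-- The gallery is contained in the apartment with chart `f`. -/
def IsIn (γ : B.Gallery n) (f : V → X) : Prop := ∀ i, γ.alcove i ⊆ Set.range f

/-- A gallery in the apartment with chart `f` is positively folded with respect to the Weyl chamber
`f '' S` (the opposite fundamental one) if, whenever it is folded at a panel, the hyperplane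
spanned by this panel separates the alcove at the fold from `f '' S`. -/
def IsPositivelyFolded (γ : B.Gallery n) (f : V → X) (S : Set V) : Prop :=
  ∀ i : Fin n, γ.alcove i.succ = γ.alcove i.castSucc →
    ∃ (j : ι) (k : ℤ), f ⁻¹' γ.panel i ⊆ R.affineHyperplane j k ∧
      R.Separates j k (f ⁻¹' γ.alcove i.succ) S

/-- The map `ρ` sends the gallery `σ` to the gallery `γ`, term by term. -/
def MapsTo (ρ : X → X) (σ γ : B.Gallery n) : Prop :=
  ρ σ.source = γ.source ∧ (∀ i, ρ '' σ.alcove i = γ.alcove i) ∧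
    (∀ i, ρ '' σ.panel i = γ.panel i) ∧ ρ σ.target = γ.target

end Gallery

/-- `ρ` is the retraction onto the apartment with chart `f` centered at the parallel class of its
Weyl chamber `f '' oppWeylChamber b o`: it maps every apartment that contains a sub-Weyl chamber
of this Weyl chamber isomorphically onto the apartment of `f`, fixing the intersection pointwise,
and it does not increase distances. -/
structure IsOppRetraction [Fintype ι] (f : V → X) (b : R.Base) (o : V) (ρ : X → X) : Prop where
  mem_range : ∀ x, ρ x ∈ Set.range f
  isomorphism : ∀ g ∈ B.charts,
    (∃ u, RootPairing.oppWeylChamber b u ⊆ RootPairing.oppWeylChamber b o ∧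
      f '' RootPairing.oppWeylChamber b u ⊆ Set.range g) →
    (∃ w ∈ R.affineWeylGroup, ∀ v, ρ (g v) = f (w v)) ∧
      ∀ x ∈ Set.range f ∩ Set.range g, ρ x = x
  dist_le : ∀ g ∈ B.charts, ∀ u v u' v' : V, ρ (g u) = f u' → ρ (g v) = f v' →
    R.weylDist u' v' ≤ R.weylDist u v

end AffineBuilding

/-! The gallery is unfolded panel by panel. Call a chart centered if it agrees with `f` on a
sub-Weyl chamber of the opposite chamber; `ρ` sends `g v` to `f v` for every such chart `g`, so each
alcove of the gallery may be lifted through its own centered chart. At a fold, thickness provides a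
third alcove on the panel, and some centered chart contains it. The alcove on the side of the center
lies in the convex hull of the panel and a remote chamber, so it belongs to the new apartment too;
the third alcove must therefore occupy the far side, exactly where positivity puts the fold
(`exists_isCentered_fold`). This gives a lift of the same type without folds (`exists_unfolding`).

Centered charts through a given point exist by `exists_chart_weylChamber`. The building axioms only
join pairs of chambers, so the apartment is found by joining a chamber to an opposite one. That the
charts match is forced by the fact that retractions centered at alcoves do not increase distances:
distances between points moving along opposite rays are compared, first in their speeds and then in
the next order term.

Minimality depends only on the type once folds are excluded (`Gallery.IsMinimal.of_type_eq`). A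
minimal gallery lies in one apartment and crosses no hyperplane twice, since otherwise reflecting a
piece of it would shorten it. An unfolded gallery with the same panel types is a copy of it in
another apartment: a panel of an alcove is determined by its type, because alcoves are strict
fundamental domains for the affine Weyl group. Any competitor is retracted to that apartment and
carried over to the minimal gallery. -/

open Filter Topology

namespace RootPairing

/-! ### Hyperplanes, closed faces and reflections -/

section Basic

variable {ι V N : Type*} [AddCommGroup V] [Module ℝ V] [AddCommGroup N] [Module ℝ N]
  (R : RootPairing ι ℝ V N)

/-- The linear form `⟨·, αᵢ^∨⟩`. -/
def ev (i : ι) : V →ₗ[ℝ] ℝ := R.coroot' i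

lemma mem_affineHyperplane {i : ι} {k : ℤ} {x : V} :
    x ∈ R.affineHyperplane i k ↔ R.ev i x = k := Iff.rfl

lemma mem_closedFace {u v : V} :
    u ∈ R.closedFace v ↔ ∀ (i : ι) (k : ℤ), (k : ℝ) ≤ R.ev i v → (k : ℝ) ≤ R.ev i u := Iff.rfl

/-- For each root only the largest admissible integer matters, so for finite `ι` a closed face is
cut out by finitely many inequalities. -/
lemma mem_closedFace_iff_floor {u v : V} :
    u ∈ R.closedFace v ↔ ∀ i, (⌊R.ev i v⌋ : ℝ) ≤ R.ev i u := by
  rw [mem_closedFace]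
  refine ⟨fun h i => h i _ (Int.floor_le _), fun h i k hk => le_trans ?_ (h i)⟩
  exact_mod_cast Int.le_floor.2 hk

lemma self_mem_closedFace (v : V) : v ∈ R.closedFace v := fun _ _ h => h

lemma closedFace_subset {u v : V} (h : u ∈ R.closedFace v) : R.closedFace u ⊆ R.closedFace v :=
  fun _ hx i k hk => hx i k (h i k hk)

lemma ev_root_self (i : ι) : R.ev i (R.root i) = 2 := R.root_coroot_two i

/-- The index of the negative of a root. -/
def negIndex : ι ↪ ι where
  toFun i := R.reflectionPerm i i
  inj' i j h := by
    apply R.root.injective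
    have := congrArg R.root h
    simpa [root_reflectionPerm, reflection_apply_self] using this

lemma root_negIndex (i : ι) : R.root (R.negIndex i) = -R.root i :=
  (R.root_reflectionPerm i i).trans (R.reflection_apply_self i)

lemma coroot_negIndex (i : ι) : R.coroot (R.negIndex i) = -R.coroot i :=
  (R.coroot_reflectionPerm i i).trans (R.coreflection_apply_self i)

lemma ev_negIndex (i : ι) (x : V) : R.ev (R.negIndex i) x = -R.ev i x := by
  change R.toLinearMap x (R.coroot _) = -R.toLinearMap x (R.coroot i)
  rw [coroot_negIndex, map_neg]

lemma exists_ev_eq_neg (i : ι) : ∃ j, ∀ x, R.ev j x = -R.ev i x :=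
  ⟨_, R.ev_negIndex i⟩

lemma le_of_mem_closedFace {u v : V} (h : u ∈ R.closedFace v) {i : ι} {k : ℤ}
    (hk : R.ev i v ≤ k) : R.ev i u ≤ k := by
  obtain ⟨j, hj⟩ := R.exists_ev_eq_neg i
  have := R.mem_closedFace.1 h j (-k) (by rw [hj]; push_cast; linarith)
  rw [hj] at this
  push_cast at this
  linarith

lemma affineReflection_apply (i : ι) (k : ℤ) (x : V) :
    R.affineReflection i k x = x - (R.ev i x - k) • R.root i := by
  have : R.affineReflection i k x = (k : ℝ) • R.root i + R.reflection i x := rfl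
  rw [this, R.reflection_apply]
  change _ + (x - R.ev i x • R.root i) = _
  module

lemma affineReflection_linear (i : ι) (k : ℤ) (x : V) :
    (R.affineReflection i k).linear x = R.reflection i x := rfl

lemma ev_affineReflection_self (i : ι) (k : ℤ) (x : V) :
    R.ev i (R.affineReflection i k x) - k = -(R.ev i x - k) := by
  rw [affineReflection_apply, map_sub, map_smul, ev_root_self, smul_eq_mul]
  ring

lemma affineReflection_affineReflection (i : ι) (k : ℤ) (x : V) :
    R.affineReflection i k (R.affineReflection i k x) = x := by
  have h := R.ev_affineReflection_self i k x
  rw [affineReflection_apply, h, affineReflection_apply]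
  module

lemma affineReflection_mul_self (i : ι) (k : ℤ) :
    R.affineReflection i k * R.affineReflection i k = 1 :=
  AffineEquiv.ext (R.affineReflection_affineReflection i k)

lemma affineReflection_inv (i : ι) (k : ℤ) :
    (R.affineReflection i k)⁻¹ = R.affineReflection i k :=
  inv_eq_of_mul_eq_one_left (R.affineReflection_mul_self i k)

lemma affineReflection_eq_self {i : ι} {k : ℤ} {x : V} (h : R.ev i x = k) :
    R.affineReflection i k x = x := by
  rw [affineReflection_apply, h]; simp

lemma affineReflection_mem (i : ι) (k : ℤ) : R.affineReflection i k ∈ R.affineWeylGroup :=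
  Subgroup.subset_closure ⟨i, k, rfl⟩

lemma isRegularPoint_iff {e : V} : R.IsRegularPoint e ↔ ∀ (i : ι) (k : ℤ), R.ev i e ≠ k := Iff.rfl

/-- Equal hyperplanes have proportional equations. -/
lemma exists_proportional {i j : ι} {k l : ℤ}
    (h : R.affineHyperplane j l = R.affineHyperplane i k) :
    ∃ c : ℝ, c ≠ 0 ∧ ∀ x, R.ev j x - l = c * (R.ev i x - k) := by
  -- The factor comes from moving `x` along the root `i` onto the common hyperplane. It cannot
  -- vanish, since `R.ev j` would then be constant, although it takes the value 2 at its own root.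
  have key : ∀ x, R.ev j x - l = R.ev j (R.root i) / 2 * (R.ev i x - k) := fun x => by
    have hx : x - ((R.ev i x - k) / 2) • R.root i ∈ R.affineHyperplane i k := by
      rw [mem_affineHyperplane, map_sub, map_smul, ev_root_self, smul_eq_mul]; ring
    rw [← h, mem_affineHyperplane, map_sub, map_smul, smul_eq_mul] at hx
    linear_combination hx
  refine ⟨_, fun h0 => ?_, key⟩
  have h1 := key 0
  have h2 := key (R.root j)
  rw [h0] at h1 h2
  rw [ev_root_self] at h2
  rw [map_zero] at h1
  linarith

/-- The point `v` lies on `H_{α,k}` and on no other hyperplane. -/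
def IsWallPoint (i : ι) (k : ℤ) (v : V) : Prop :=
  R.ev i v = k ∧ ∀ (j : ι) (l : ℤ), R.ev j v = l → R.affineHyperplane j l = R.affineHyperplane i k

lemma isPanel_iff {p : Set V} :
    R.IsPanel p ↔ ∃ v i k, R.IsWallPoint i k v ∧ p = R.closedFace v := by
  constructor
  · rintro ⟨v, ⟨H, ⟨⟨i, k, rfl⟩, hv⟩, hu⟩, rfl⟩
    exact ⟨v, i, k, ⟨hv, fun j l hl => hu _ ⟨⟨j, l, rfl⟩, hl⟩⟩, rfl⟩
  · rintro ⟨v, i, k, ⟨hv, hu⟩, rfl⟩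
    refine ⟨v, ⟨_, ⟨⟨i, k, rfl⟩, hv⟩, ?_⟩, rfl⟩
    rintro H ⟨⟨j, l, rfl⟩, hl⟩
    exact hu j l hl

lemma closedFace_eq_of_not_separated {e e' : V}
    (h : ∀ (j : ι) (l : ℤ), (l : ℝ) ≤ R.ev j e → (l : ℝ) ≤ R.ev j e')
    (h' : ∀ (j : ι) (l : ℤ), (l : ℝ) ≤ R.ev j e' → (l : ℝ) ≤ R.ev j e) :
    R.closedFace e = R.closedFace e' :=
  Set.Subset.antisymm (R.closedFace_subset h') (R.closedFace_subset h)

/-- If a half space contained `e'` but not `e`, then `e'`, lying in the closed face of `e`, would be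
on its boundary, contrary to regularity. -/
lemma closedFace_eq_of_mem {e e' : V} (he' : R.IsRegularPoint e')
    (h : e' ∈ R.closedFace e) : R.closedFace e = R.closedFace e' := by
  refine R.closedFace_eq_of_not_separated h fun j l hl => ?_
  by_contra hlt
  have := R.le_of_mem_closedFace h (not_le.1 hlt).le
  exact he' j l (le_antisymm this hl)

/-- A hyperplane that separates two alcoves passes through their common points. -/
lemma ev_eq_of_separated {e e' v : V} (hv : v ∈ R.closedFace e) (hv' : v ∈ R.closedFace e')
    {j : ι} {l : ℤ} (h : (l : ℝ) ≤ R.ev j e) (h' : R.ev j e' ≤ l) : R.ev j v = l :=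
  le_antisymm (R.le_of_mem_closedFace hv' h') (hv j l h)

/-- Of the alcoves containing a given panel, there is just one on each side. -/
lemma closedFace_eq_of_sameSide {e e' v : V} {i : ι} {k : ℤ} (hw : R.IsWallPoint i k v)
    (hv : v ∈ R.closedFace e) (hv' : v ∈ R.closedFace e')
    (hs : 0 < (R.ev i e - k) * (R.ev i e' - k)) :
    R.closedFace e = R.closedFace e' := by
  have main : ∀ e e' : V, v ∈ R.closedFace e → v ∈ R.closedFace e' →
      0 < (R.ev i e - k) * (R.ev i e' - k) →
      ∀ (j : ι) (l : ℤ), (l : ℝ) ≤ R.ev j e → (l : ℝ) ≤ R.ev j e' := by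
    intro e e' hv hv' hs j l hl
    by_contra hlt
    rw [not_le] at hlt
    obtain ⟨c, hc, hp⟩ := R.exists_proportional (hw.2 j l (R.ev_eq_of_separated hv hv' hl hlt.le))
    have h1 := hp e
    have h2 := hp e'
    have h3 : 0 ≤ c * (R.ev i e - k) := by linarith
    have h4 : c * (R.ev i e' - k) < 0 := by linarith
    have h5 : c * (R.ev i e - k) * (c * (R.ev i e' - k)) ≤ 0 :=
      mul_nonpos_of_nonneg_of_nonpos h3 h4.le
    have h6 : 0 < c * c := mul_self_pos.2 hc
    nlinarith [mul_pos h6 hs]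
  exact R.closedFace_eq_of_not_separated (main e e' hv hv' hs)
    (main e' e hv' hv (by rwa [mul_comm]))

/-- A half space that contains a point of a panel but not the alcove at this panel is bounded by
the hyperplane of the panel. -/
lemma hyperplane_eq_of_not_mem {e v : V} {i : ι} {k : ℤ} (hw : R.IsWallPoint i k v)
    (hv : v ∈ R.closedFace e) {j : ι} {l : ℤ} (hl : (l : ℝ) ≤ R.ev j v) (hlt : R.ev j e < l) :
    R.affineHyperplane j l = R.affineHyperplane i k :=
  hw.2 j l (le_antisymm (R.le_of_mem_closedFace hv hlt.le) hl)

lemma ev_map_eq_iff {w : V ≃ᵃ[ℝ] V} {i j : ι} {k l : ℤ}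
    (h : ∀ x, R.ev i (w x) - k = R.ev j x - l) (x : V) : R.ev i (w x) = k ↔ R.ev j x = l := by
  rw [← sub_eq_zero, h, sub_eq_zero]

end Basic

/-! ### Action of the affine Weyl group on the hyperplane arrangement -/

section Weyl

variable {ι V N : Type*} [AddCommGroup V] [Module ℝ V] [AddCommGroup N] [Module ℝ N]
  {R : RootPairing ι ℝ V N} [R.IsCrystallographic]

lemma exists_ev_affineReflection (i : ι) (a : ι) (k : ℤ) :
    ∃ (j : ι) (m : ℤ), (∀ x, R.ev i (R.affineReflection a k x) = R.ev j x + m) ∧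
      (R.affineReflection a k).linear (R.root j) = R.root i := by
  obtain ⟨z, hz⟩ := R.exists_value (S := ℤ) a i
  refine ⟨R.reflectionPerm a i, k * z, fun x => ?_, ?_⟩
  · have h : R.ev (R.reflectionPerm a i) x = R.ev i (R.reflection a x) :=
      (R.coroot'_reflection x).symm
    have h2 : R.ev i (R.root a) = z := (R.root_coroot'_eq_pairing i a).trans hz.symm
    rw [h, R.reflection_apply, affineReflection_apply]
    change _ = R.ev i (x - R.ev a x • R.root a) + _
    simp only [map_sub, map_smul, smul_eq_mul, h2]
    push_cast; ring
  · rw [affineReflection_linear, R.root_reflectionPerm]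
    simp

/-- The shifts are integers because the root system is crystallographic. The root is tracked along
with the form so that injectivity of `R.root` later turns `i ↦ j` into a permutation. -/
lemma exists_ev_weyl {w : V ≃ᵃ[ℝ] V} (hw : w ∈ R.affineWeylGroup) (i : ι) :
    ∃ (j : ι) (m : ℤ), (∀ x, R.ev i (w x) = R.ev j x + m) ∧ w.linear (R.root j) = R.root i := by
  -- The claim for the inverse is part of the induction, so that the inverse case only swaps the two
  -- halves.
  suffices H : (∀ i, ∃ (j : ι) (m : ℤ), (∀ x, R.ev i (w x) = R.ev j x + m) ∧
      w.linear (R.root j) = R.root i) ∧ (∀ i, ∃ (j : ι) (m : ℤ),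
      (∀ x, R.ev i (w⁻¹ x) = R.ev j x + m) ∧ (w⁻¹).linear (R.root j) = R.root i) from H.1 i
  have hmul : ∀ a b : V ≃ᵃ[ℝ] V,
      (∀ i, ∃ (j : ι) (m : ℤ), (∀ x, R.ev i (a x) = R.ev j x + m) ∧
        a.linear (R.root j) = R.root i) →
      (∀ i, ∃ (j : ι) (m : ℤ), (∀ x, R.ev i (b x) = R.ev j x + m) ∧
        b.linear (R.root j) = R.root i) →
      (∀ i, ∃ (j : ι) (m : ℤ), (∀ x, R.ev i ((a * b) x) = R.ev j x + m) ∧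
        (a * b).linear (R.root j) = R.root i) := by
    intro a b ha hb i
    obtain ⟨j, m, h1, h2⟩ := ha i
    obtain ⟨j', m', h1', h2'⟩ := hb j
    refine ⟨j', m' + m, fun x => ?_, ?_⟩
    · rw [AffineEquiv.mul_def, AffineEquiv.trans_apply, h1, h1']; push_cast; ring
    · change a.linear (b.linear _) = _
      rw [h2', h2]
  induction hw using Subgroup.closure_induction with
  | mem w hw =>
    obtain ⟨a, k, rfl⟩ := hw
    rw [affineReflection_inv]
    exact ⟨fun i => exists_ev_affineReflection i a k, fun i => exists_ev_affineReflection i a k⟩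
  | one =>
    rw [inv_one]
    exact ⟨fun i => ⟨i, 0, fun x => by simp, rfl⟩, fun i => ⟨i, 0, fun x => by simp, rfl⟩⟩
  | mul a b _ _ iha ihb =>
    rw [mul_inv_rev]
    exact ⟨hmul _ _ iha.1 ihb.1, hmul _ _ ihb.2 iha.2⟩
  | inv a _ iha => rw [inv_inv]; exact ⟨iha.2, iha.1⟩

lemma weyl_mem_closedFace {w : V ≃ᵃ[ℝ] V} (hw : w ∈ R.affineWeylGroup) {u v : V}
    (h : u ∈ R.closedFace v) : w u ∈ R.closedFace (w v) := by
  intro i k hk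
  obtain ⟨j, m, hj, -⟩ := exists_ev_weyl hw i
  have h1 : ((k - m : ℤ) : ℝ) ≤ R.ev j v := by
    have : (k : ℝ) ≤ R.ev i (w v) := hk
    rw [hj] at this; push_cast; linarith
  have h2 : ((k - m : ℤ) : ℝ) ≤ R.ev j u := h j _ h1
  change (k : ℝ) ≤ R.ev i (w u)
  rw [hj]; push_cast at h2; linarith

lemma weyl_inv_apply (w : V ≃ᵃ[ℝ] V) (x : V) : w⁻¹ (w x) = x := w.symm_apply_apply x

lemma weyl_apply_inv (w : V ≃ᵃ[ℝ] V) (x : V) : w (w⁻¹ x) = x := w.apply_symm_apply x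

lemma image_closedFace {w : V ≃ᵃ[ℝ] V} (hw : w ∈ R.affineWeylGroup) (v : V) :
    w '' R.closedFace v = R.closedFace (w v) := by
  ext u
  constructor
  · rintro ⟨x, hx, rfl⟩
    exact weyl_mem_closedFace hw hx
  · intro hu
    refine ⟨w⁻¹ u, ?_, weyl_apply_inv w u⟩
    have := weyl_mem_closedFace (inv_mem hw) hu
    rwa [weyl_inv_apply] at this

lemma isRegularPoint_weyl {w : V ≃ᵃ[ℝ] V} (hw : w ∈ R.affineWeylGroup) {e : V}
    (he : R.IsRegularPoint e) : R.IsRegularPoint (w e) := by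
  rw [isRegularPoint_iff] at he ⊢
  intro i k hk
  obtain ⟨j, m, hj, -⟩ := exists_ev_weyl hw i
  refine he j (k - m) ?_
  rw [hj] at hk; push_cast; linarith

/-- Conjugates of affine reflections are affine reflections. -/
lemma weyl_conj_affineReflection {w : V ≃ᵃ[ℝ] V} (hw : w ∈ R.affineWeylGroup) (i : ι) (k : ℤ) :
    ∃ (j : ι) (l : ℤ), (∀ x, R.ev i (w x) - k = R.ev j x - l) ∧
      w⁻¹ * R.affineReflection i k * w = R.affineReflection j l := by
  obtain ⟨j, m, hj, hr⟩ := exists_ev_weyl hw i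
  refine ⟨j, k - m, fun x => by rw [hj]; push_cast; ring, ?_⟩
  rw [mul_assoc, inv_mul_eq_iff_eq_mul]
  ext x
  change R.affineReflection i k (w x) = w (R.affineReflection j (k - m) x)
  rw [affineReflection_apply, affineReflection_apply, hj, ← hr]
  have : x - (R.ev j x - ((k - m : ℤ) : ℝ)) • R.root j =
    (-(R.ev j x - ((k - m : ℤ) : ℝ)) • R.root j) +ᵥ x := by
      rw [vadd_eq_add]; module
  rw [this, AffineEquiv.map_vadd, map_smul, vadd_eq_add]
  push_cast
  module

lemma isWallPoint_weyl {w : V ≃ᵃ[ℝ] V} (hw : w ∈ R.affineWeylGroup) {i : ι} {k : ℤ} {v : V}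
    (hv : R.IsWallPoint i k (w v)) {j : ι} {l : ℤ} (h : ∀ x, R.ev i (w x) - k = R.ev j x - l) :
    R.IsWallPoint j l v := by
  refine ⟨(R.ev_map_eq_iff h v).1 hv.1, fun a m ha => ?_⟩
  obtain ⟨a', m', ha', -⟩ := weyl_conj_affineReflection (inv_mem hw) a m
  have h1 : R.affineHyperplane a' m' = R.affineHyperplane i k := by
    refine hv.2 a' m' ?_
    rw [← R.ev_map_eq_iff ha', weyl_inv_apply, ha]
  ext x
  have h2 : w x ∈ R.affineHyperplane a' m' ↔ w x ∈ R.affineHyperplane i k := by rw [h1]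
  rw [mem_affineHyperplane, mem_affineHyperplane, ← R.ev_map_eq_iff ha',
    weyl_inv_apply, R.ev_map_eq_iff h] at h2
  exact h2

end Weyl

end RootPairing

namespace RootPairing

/-! ### The invariant Euclidean structure -/

section Euclidean

variable {ι V N : Type*} [AddCommGroup V] [Module ℝ V] [AddCommGroup N] [Module ℝ N]
  (R : RootPairing ι ℝ V N)

lemma eq_zero_of_ev_eq_zero [R.IsRootSystem] {x : V} (h : ∀ i, R.ev i x = 0) : x = 0 := by
  have h0 : R.toLinearMap x = 0 := by
    refine LinearMap.ext_on_range (v := R.coroot) IsRootSystem.span_coroot_eq_top fun i => ?_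
    exact h i
  exact (LinearMap.IsPerfPair.bijective_left (p := R.toLinearMap)).1 (h0.trans (map_zero _).symm)

lemma hyperplane_eq_of_ker {i j : ι} {k l : ℤ} {p : V} (hi : R.ev i p = k) (hj : R.ev j p = l)
    (h : ∀ u, R.ev i u = 0 → R.ev j u = 0) : R.affineHyperplane j l = R.affineHyperplane i k := by
  have key : ∀ x, R.ev j x - l = R.ev j (R.root i) / 2 * (R.ev i x - k) := fun x => by
    have := h (x - p - ((R.ev i x - k) / 2) • R.root i) (by
      simp only [map_sub, map_smul, smul_eq_mul, ev_root_self, hi]; ring)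
    simp only [map_sub, map_smul, smul_eq_mul, hj] at this
    linear_combination this
  have hne : R.ev j (R.root i) / 2 ≠ 0 := fun h0 => by
    have h1 := key (p + R.root j)
    rw [h0, map_add, hj, ev_root_self] at h1
    linarith
  ext x
  rw [mem_affineHyperplane, mem_affineHyperplane, ← sub_eq_zero, key, mul_eq_zero,
    or_iff_right hne, sub_eq_zero]

/-- The embedding of `V` into a Euclidean space by the coroots. -/
def toE : V →ₗ[ℝ] EuclideanSpace ℝ ι :=
  (WithLp.linearEquiv 2 ℝ (ι → ℝ)).symm.toLinearMap ∘ₗ LinearMap.pi R.ev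

lemma toE_apply (x : V) (i : ι) : R.toE x i = R.ev i x := rfl

lemma toE_injective [R.IsRootSystem] : Function.Injective R.toE := by
  rw [← LinearMap.ker_eq_bot, LinearMap.ker_eq_bot']
  intro x hx
  refine R.eq_zero_of_ev_eq_zero fun i => ?_
  rw [← toE_apply, hx]; rfl

variable [Fintype ι]

lemma inner_toE (x y : V) : inner ℝ (R.toE x) (R.toE y) = ∑ i, R.ev i x * R.ev i y := by
  rw [PiLp.inner_apply]
  refine Finset.sum_congr rfl fun i _ => ?_
  rw [toE_apply, toE_apply]
  change R.ev i y * R.ev i x = _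
  ring

variable {R} [R.IsCrystallographic]

/-- Elements of the affine Weyl group permute the coroots, up to integers. -/
lemma exists_perm_weyl {w : V ≃ᵃ[ℝ] V} (hw : w ∈ R.affineWeylGroup) :
    ∃ (π : Equiv.Perm ι) (m : ι → ℤ), ∀ i x, R.ev i (w x) = R.ev (π i) x + m i := by
  choose π m h hr using fun i => exists_ev_weyl hw i
  have hinj : Function.Injective π := fun i j hij => by
    apply R.root.injective
    rw [← hr i, ← hr j, hij]
  exact ⟨Equiv.ofBijective π (Finite.injective_iff_bijective.1 hinj), m, h⟩

/-- A permutation of the coordinates preserves the norm, and the integer shifts cancel in the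
difference. -/
lemma norm_toE_weyl_sub {w : V ≃ᵃ[ℝ] V} (hw : w ∈ R.affineWeylGroup) (x y : V) :
    ‖R.toE (w x - w y)‖ = ‖R.toE (x - y)‖ := by
  obtain ⟨π, m, h⟩ := exists_perm_weyl hw
  have : ‖R.toE (w x - w y)‖ ^ 2 = ‖R.toE (x - y)‖ ^ 2 := by
    rw [← real_inner_self_eq_norm_sq, ← real_inner_self_eq_norm_sq, inner_toE, inner_toE,
      ← Equiv.sum_comp π fun i => R.ev i (x - y) * R.ev i (x - y)]
    refine Finset.sum_congr rfl fun i _ => ?_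
    simp only [map_sub, h]; ring
  exact (sq_eq_sq₀ (norm_nonneg _) (norm_nonneg _)).1 this

omit [R.IsCrystallographic] in
lemma linear_eq_sub (w : V ≃ᵃ[ℝ] V) (u x : V) : w.linear u = w (x + u) - w x := by
  rw [← vsub_eq_sub, ← AffineEquiv.coe_toAffineMap, ← AffineMap.linearMap_vsub]
  simp

lemma norm_toE_linear {w : V ≃ᵃ[ℝ] V} (hw : w ∈ R.affineWeylGroup) (x : V) :
    ‖R.toE (w.linear x)‖ = ‖R.toE x‖ := by
  rw [linear_eq_sub w x 0, norm_toE_weyl_sub hw]; simp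

/-- Reflections preserve the norm; expanding `‖x - R.ev i x • R.root i‖² = ‖x‖²` and cancelling
`R.ev i x` gives the formula. If `R.ev i x = 0`, the same is done for `x + R.root i`, whose
reflection is `x - R.root i`. -/
lemma inner_toE_root (i : ι) (x : V) :
    2 * inner ℝ (R.toE x) (R.toE (R.root i)) =
      R.ev i x * inner ℝ (R.toE (R.root i)) (R.toE (R.root i)) := by
  have hcomm := real_inner_comm (R.toE x) (R.toE (R.root i))
  have h := norm_toE_linear (R.affineReflection_mem i 0) x
  have h1 : (R.affineReflection i 0).linear x = x - R.ev i x • R.root i := by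
    rw [affineReflection_linear, R.reflection_apply]; rfl
  have h2 := congrArg (· ^ 2) h
  simp only [h1, map_sub, map_smul] at h2
  rw [← real_inner_self_eq_norm_sq, ← real_inner_self_eq_norm_sq, inner_sub_left, inner_sub_right,
    inner_sub_right, inner_smul_left, inner_smul_right, inner_smul_left, inner_smul_right] at h2
  simp only [conj_trivial] at h2
  by_cases h0 : R.ev i x = 0
  · have h' := norm_toE_linear (R.affineReflection_mem i 0) (x + R.root i)
    have h1' : (R.affineReflection i 0).linear (x + R.root i) = x - R.root i := by
      rw [affineReflection_linear, R.reflection_apply]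
      change (x + R.root i) - R.ev i (x + R.root i) • R.root i = _
      rw [map_add, h0, ev_root_self]; module
    have h3 := congrArg (· ^ 2) h'
    simp only [h1', map_sub, map_add] at h3
    rw [← real_inner_self_eq_norm_sq, ← real_inner_self_eq_norm_sq, inner_sub_left,
      inner_sub_right, inner_sub_right, inner_add_left, inner_add_right, inner_add_right] at h3
    rw [h0]
    linarith
  · apply mul_left_cancel₀ h0
    rw [hcomm] at h2
    linear_combination -h2

/-- The two forms are proportional, so both kill `d = c • R.root j - R.root i`. By `inner_toE_root`
this vector is orthogonal to both roots, hence to itself, and vanishes. -/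
lemma affineReflection_eq_of_hyperplane_eq [R.IsRootSystem] {i j : ι} {k l : ℤ}
    (h : R.affineHyperplane j l = R.affineHyperplane i k) :
    R.affineReflection j l = R.affineReflection i k := by
  obtain ⟨c, hc, hp⟩ := R.exists_proportional h
  have hlin : ∀ x, R.ev j x = c * R.ev i x := fun x => by
    have h1 := hp x
    have h2 := hp 0
    simp only [map_zero] at h2
    linarith
  have hd : c • R.root j - R.root i = 0 := by
    set d := c • R.root j - R.root i with hd
    have hi : R.ev i d = 0 := by
      rw [hd, map_sub, map_smul, ev_root_self, smul_eq_mul, ← hlin, ev_root_self, sub_self]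
    have hj : R.ev j d = 0 := by rw [hlin, hi, mul_zero]
    have h1 := inner_toE_root (R := R) i d
    have h2 := inner_toE_root (R := R) j d
    rw [hi] at h1
    rw [hj] at h2
    have h3 : inner ℝ (R.toE d) (R.toE d) = 0 := by
      have hT : R.toE d = c • R.toE (R.root j) - R.toE (R.root i) := by
        rw [hd, map_sub, map_smul]
      have h4 : inner ℝ (R.toE d) (R.toE d) =
          inner ℝ (R.toE d) (c • R.toE (R.root j) - R.toE (R.root i)) := by rw [← hT]
      rw [h4, inner_sub_right, inner_smul_right]
      linear_combination c / 2 * h2 - h1 / 2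
    exact R.toE_injective ((inner_self_eq_zero.1 h3).trans (map_zero _).symm)
  ext x
  rw [affineReflection_apply, affineReflection_apply, hp x, ← sub_eq_zero.1 hd]
  module

end Euclidean

/-! ### Small perturbations and walls of alcoves -/

section Eventually

variable {ι V N : Type*} [AddCommGroup V] [Module ℝ V] [AddCommGroup N] [Module ℝ N]
  (R : RootPairing ι ℝ V N)

lemma tendsto_ev (i : ι) (p u : V) :
    Tendsto (fun s : ℝ => R.ev i (p + s • u)) (𝓝[>] 0) (𝓝 (R.ev i p)) := by
  have : Continuous fun s : ℝ => R.ev i p + s * R.ev i u := by fun_prop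
  have h := (this.tendsto 0).mono_left (nhdsWithin_le_nhds (s := Set.Ioi 0))
  simpa using h

/-- Just after time zero a nonconstant affine function lies strictly between its initial value and
the next integer in its direction. -/
lemma eventually_forall_int_ne (c : ℝ) {a : ℝ} (ha : a ≠ 0) :
    ∀ᶠ s : ℝ in 𝓝[>] 0, ∀ m : ℤ, c + s * a ≠ m := by
  have hc : Continuous fun s : ℝ => c + s * a := by fun_prop
  have ht : Tendsto (fun s : ℝ => c + s * a) (𝓝[>] 0) (𝓝 c) := by
    simpa using (hc.tendsto 0).mono_left (nhdsWithin_le_nhds (s := Set.Ioi 0))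
  rcases lt_or_gt_of_ne ha with ha | ha
  · filter_upwards [ht.eventually (lt_mem_nhds (show (⌈c⌉ : ℝ) - 1 < c by
      linarith [Int.ceil_lt_add_one c])), self_mem_nhdsWithin] with s h1 hs m hm
    have hs : 0 < s := hs
    have h2 : c + s * a < ⌈c⌉ := by nlinarith [Int.le_ceil c]
    rw [hm] at h1 h2
    have h1' : ⌈c⌉ - 1 < m := by exact_mod_cast h1
    have h2' : m < ⌈c⌉ := by exact_mod_cast h2
    omega
  · filter_upwards [ht.eventually (gt_mem_nhds (Int.lt_floor_add_one c)),
      self_mem_nhdsWithin] with s h1 hs m hm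
    have hs : 0 < s := hs
    have h2 : (⌊c⌋ : ℝ) < c + s * a := by nlinarith [Int.floor_le c, mul_pos hs ha]
    rw [hm] at h1 h2
    have h1' : m < ⌊c⌋ + 1 := by exact_mod_cast h1
    have h2' : ⌊c⌋ < m := by exact_mod_cast h2
    omega

/-- Starting from `p` one may go a bit into any direction without leaving `U`. -/
def Absorbs (U : Set V) (p : V) : Prop := ∀ u : V, ∀ᶠ s : ℝ in 𝓝[>] 0, p + s • u ∈ U

variable {R}

/-- `V` carries no topology, so `Absorbs` replaces interior points: every ray from `p` has a further
point in `U`, and two points determine an affine map on a line. -/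
lemma Absorbs.affine_ext {U : Set V} {p : V} (h : Absorbs U p) {w w' : V ≃ᵃ[ℝ] V}
    (hw : ∀ x ∈ U, w x = w' x) : w = w' := by
  have hp : p ∈ U := by
    obtain ⟨s, hs⟩ := (h 0).exists
    simpa using hs
  ext x
  obtain ⟨s, hs, hs0⟩ := ((h (x - p)).and self_mem_nhdsWithin).exists
  have hs0 : 0 < s := hs0
  have h1 := hw _ hs
  have key : ∀ f : V ≃ᵃ[ℝ] V, f (p + s • (x - p)) = s • (f x - f p) + f p := fun f => by
    have h2 := linear_eq_sub f (s • (x - p)) p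
    have h3 := linear_eq_sub f (x - p) p
    rw [map_smul, h3, add_sub_cancel] at h2
    rw [h2]; abel
  rw [key, key, hw p hp, add_left_inj] at h1
  have h2 := smul_right_injective V hs0.ne' h1
  simpa using h2

variable [Finite ι]

lemma absorbs_closedFace {e : V} (he : R.IsRegularPoint e) : Absorbs (R.closedFace e) e := by
  intro u
  simp only [mem_closedFace_iff_floor, eventually_all]
  intro i
  have : (⌊R.ev i e⌋ : ℝ) < R.ev i e :=
    lt_of_le_of_ne (Int.floor_le _) fun h => he i _ h.symm
  filter_upwards [(R.tendsto_ev i e u).eventually (lt_mem_nhds this)] with s hs using hs.le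

/-- Points near `v` have `v` in their closed face. -/
lemma eventually_mem_closedFace (v u : V) : ∀ᶠ s : ℝ in 𝓝[>] 0, v ∈ R.closedFace (v + s • u) := by
  simp only [mem_closedFace_iff_floor, eventually_all]
  intro i
  filter_upwards [(R.tendsto_ev i v u).eventually (gt_mem_nhds (Int.lt_floor_add_one _))] with s hs
  have : ⌊R.ev i (v + s • u)⌋ ≤ ⌊R.ev i v⌋ := by
    have := Int.floor_lt.2 (show R.ev i (v + s • u) < ((⌊R.ev i v⌋ + 1 : ℤ) : ℝ) by
      push_cast; exact hs)
    omega
  exact (Int.cast_le.2 this).trans (Int.floor_le _)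

variable (R) in
/-- Every hyperplane contains a point that lies on no other hyperplane. -/
lemma exists_isWallPoint (i : ι) (k : ℤ) : ∃ v, R.IsWallPoint i k v := by
  classical
  -- A direction inside the hyperplane that is transverse to every hyperplane not parallel to it. A
  -- short step in this direction from the point `(k / 2) • R.root i` of `H_{α,k}` leaves all the
  -- others.
  obtain ⟨u, hu, hne⟩ := Module.Dual.exists_forall_mem_ne_zero_of_forall_exists
    (LinearMap.ker (R.ev i)) (fun j : {j // ∃ x, R.ev i x = 0 ∧ R.ev j x ≠ 0} => R.ev j)
    (fun j => ⟨j.2.choose, j.2.choose_spec.1, j.2.choose_spec.2⟩)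
  have hu : R.ev i u = 0 := hu
  have hev : ∀ᶠ s : ℝ in 𝓝[>] 0, ∀ j : {j // ∃ x, R.ev i x = 0 ∧ R.ev j x ≠ 0},
      ∀ m : ℤ, R.ev j (((k : ℝ) / 2) • R.root i) + s * R.ev j u ≠ m :=
    eventually_all.2 fun j => eventually_forall_int_ne _ (hne j)
  obtain ⟨s, hs⟩ := hev.exists
  have hv : R.ev i (((k : ℝ) / 2) • R.root i + s • u) = k := by
    rw [map_add, map_smul, map_smul, hu, ev_root_self, smul_eq_mul, smul_zero]; ring
  refine ⟨((k : ℝ) / 2) • R.root i + s • u, hv, fun j l hl => ?_⟩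
  refine R.hyperplane_eq_of_ker hv hl fun x hx => ?_
  by_contra h0
  refine hs ⟨j, x, hx, h0⟩ l ?_
  rw [← hl, map_add, map_smul, map_smul]
  simp only [smul_eq_mul]

/-- A point outside of an alcove is separated from the alcove by a wall of the alcove. -/
lemma exists_wall_separating {e y : V} (he : R.IsRegularPoint e) (hy : y ∉ R.closedFace e) :
    ∃ i k p, R.IsWallPoint i k p ∧ p ∈ R.closedFace e ∧ (k : ℝ) < R.ev i e ∧ R.ev i y < k := by
  classical
  cases nonempty_fintype ι
  let S : Set (Finset ι) :=
    {J | ∀ x, (∀ j ∈ J, (⌊R.ev j e⌋ : ℝ) ≤ R.ev j x) → x ∈ R.closedFace e}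
  -- A minimal set of inequalities defining the alcove. Each of them is irredundant, so some `x`
  -- violates only the one violated by `y`. The segment from `e` to `x` meets that hyperplane in
  -- `p`, where all other inequalities of `J` are strict.
  obtain ⟨J, hJ, hmin⟩ := (wellFounded_lt (α := Finset ι)).has_min S
    ⟨Finset.univ, fun x hx => R.mem_closedFace_iff_floor.2 fun i => hx i (Finset.mem_univ i)⟩
  have hlt : ∀ j, (⌊R.ev j e⌋ : ℝ) < R.ev j e := fun j =>
    lt_of_le_of_ne (Int.floor_le _) fun h => he j _ h.symm
  obtain ⟨i, hiJ, hiy⟩ : ∃ i ∈ J, R.ev i y < ⌊R.ev i e⌋ := by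
    by_contra! h
    exact hy (hJ y h)
  obtain ⟨x, hx, hxD⟩ : ∃ x, (∀ j ∈ J.erase i, (⌊R.ev j e⌋ : ℝ) ≤ R.ev j x) ∧
      x ∉ R.closedFace e := by
    by_contra! h
    exact hmin _ (show J.erase i ∈ S from h) (Finset.erase_ssubset hiJ)
  set k := ⌊R.ev i e⌋ with hk
  have hxk : R.ev i x < k := by
    by_contra! h
    refine hxD (hJ x fun j hj => ?_)
    by_cases hji : j = i
    · subst hji; exact h
    · exact hx j (Finset.mem_erase.2 ⟨hji, hj⟩)
  set t : ℝ := (R.ev i e - k) / (R.ev i e - R.ev i x) with ht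
  have hd : 0 < R.ev i e - R.ev i x := by linarith [hlt i]
  have ht0 : 0 < t := div_pos (by linarith [hlt i]) hd
  have ht1 : t < 1 := (div_lt_one hd).2 (by linarith)
  set p := e + t • (x - e) with hp
  have evp : ∀ j, R.ev j p = R.ev j e + t * (R.ev j x - R.ev j e) := fun j => by
    rw [hp, map_add, map_smul, map_sub, smul_eq_mul]
  have hpi : R.ev i p = k := by
    rw [evp, ht]; field_simp; ring
  have hpj : ∀ j ∈ J.erase i, (⌊R.ev j e⌋ : ℝ) < R.ev j p := fun j hj => by
    rw [evp]
    nlinarith [hlt j, hx j hj]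
  have hpJ : ∀ j ∈ J, (⌊R.ev j e⌋ : ℝ) ≤ R.ev j p := fun j hj => by
    by_cases hji : j = i
    · subst hji; exact hpi.ge
    · exact (hpj j (Finset.mem_erase.2 ⟨hji, hj⟩)).le
  have hpD : p ∈ R.closedFace e := hJ p hpJ
  refine ⟨i, k, p, ⟨hpi, fun j l hl => ?_⟩, hpD, hlt i, hiy⟩
  -- Near `p` the hyperplane stays inside the alcove. Any other hyperplane through `p` has the
  -- alcove on one side, so its form has one sign on `ker (R.ev i)` and therefore vanishes there.
  have hker : ∀ u, R.ev i u = 0 → ∀ᶠ s : ℝ in 𝓝[>] 0, p + s • u ∈ R.closedFace e := by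
    intro u hu
    have : ∀ᶠ s : ℝ in 𝓝[>] 0, ∀ j ∈ J.erase i, (⌊R.ev j e⌋ : ℝ) < R.ev j (p + s • u) :=
      (Finset.eventually_all (J.erase i)).2 fun j hj =>
        (R.tendsto_ev j p u).eventually (lt_mem_nhds (hpj j hj))
    filter_upwards [this] with s hs
    refine hJ _ fun j hj => ?_
    by_cases hji : j = i
    · subst hji; rw [map_add, map_smul, hu, hpi, smul_zero, add_zero]
    · exact (hs j (Finset.mem_erase.2 ⟨hji, hj⟩)).le
  have main : ∀ u, R.ev i u = 0 → ∀ j (l : ℤ), R.ev j p = l → (l : ℝ) ≤ R.ev j e →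
      0 ≤ R.ev j u := by
    intro u hu j l hl hle
    obtain ⟨s, hs, hs0⟩ := ((hker u hu).and self_mem_nhdsWithin).exists
    have hs0 : 0 < s := hs0
    have := R.mem_closedFace.1 hs j l hle
    rw [map_add, map_smul, hl, smul_eq_mul] at this
    by_contra! hneg
    nlinarith
  have main' : ∀ j (l : ℤ), R.ev j p = l → (l : ℝ) ≤ R.ev j e →
      ∀ u, R.ev i u = 0 → R.ev j u = 0 := by
    intro j l hl hle u hu
    have h1 := main u hu j l hl hle
    have h2 := main (-u) (by rw [map_neg, hu, neg_zero]) j l hl hle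
    rw [map_neg] at h2
    linarith
  refine R.hyperplane_eq_of_ker hpi hl ?_
  rcases le_total (l : ℝ) (R.ev j e) with h | h
  · exact main' j l hl h
  · obtain ⟨j', hj'⟩ := R.exists_ev_eq_neg j
    intro u hu
    have := main' j' (-l) (by rw [hj', hl]; push_cast; rfl)
      (by rw [hj']; push_cast; linarith) u hu
    rw [hj'] at this
    linarith

end Eventually

end RootPairing

namespace RootPairing

/-! ### Alcoves as strict fundamental domains -/

section FundamentalDomain

variable {ι V N : Type*} [AddCommGroup V] [Module ℝ V] [AddCommGroup N] [Module ℝ N]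
  (R : RootPairing ι ℝ V N)

/-- The reflections at the walls of the alcove of `e`. -/
def wallReflections (e : V) : Set (V ≃ᵃ[ℝ] V) :=
  {s | ∃ i k v, R.IsWallPoint i k v ∧ v ∈ R.closedFace e ∧ s = R.affineReflection i k}

/-- The number of pairs `(α, k)` such that the hyperplane `H_{α,k}` separates `y` from the regular
point `e`. -/
noncomputable def depth [Fintype ι] (e y : V) : ℕ := ∑ i, (⌊R.ev i e⌋ - ⌊R.ev i y⌋).natAbs

variable {R}

lemma closure_wallReflections_le (e : V) :
    Subgroup.closure (R.wallReflections e) ≤ R.affineWeylGroup := by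
  rw [Subgroup.closure_le]
  rintro s ⟨i, k, v, -, -, rfl⟩
  exact R.affineReflection_mem i k

variable [Fintype ι] [R.IsCrystallographic]

lemma depth_weyl {w : V ≃ᵃ[ℝ] V} (hw : w ∈ R.affineWeylGroup) (e y : V) :
    R.depth (w e) (w y) = R.depth e y := by
  obtain ⟨π, m, h⟩ := exists_perm_weyl hw
  rw [depth, depth, ← Equiv.sum_comp π fun i => (⌊R.ev i e⌋ - ⌊R.ev i y⌋).natAbs]
  refine Finset.sum_congr rfl fun i _ => ?_
  rw [h, h, Int.floor_add_intCast, Int.floor_add_intCast, add_sub_add_right_eq_sub]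

/-- By invariance the reflection may be applied to `e` instead of `y`. The alcoves of `e` and `s e`
share the wall point `v`, so only the hyperplane of the wall separates them; every floor that
changes moves by one towards that of `y`. -/
lemma depth_affineReflection_lt {e y v : V} (he : R.IsRegularPoint e) {i : ι} {k : ℤ}
    (hv : R.IsWallPoint i k v) (hve : v ∈ R.closedFace e) (h1 : (k : ℝ) < R.ev i e)
    (h2 : R.ev i y < k) : R.depth e (R.affineReflection i k y) < R.depth e y := by
  set s := R.affineReflection i k with hs
  have hsW : s ∈ R.affineWeylGroup := R.affineReflection_mem i k
  have e1 : R.depth e (s y) = R.depth (s e) y := by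
    rw [← depth_weyl hsW (s e) y, hs, affineReflection_affineReflection]
  have hse : R.IsRegularPoint (s e) := isRegularPoint_weyl hsW he
  have hvs : v ∈ R.closedFace (s e) := by
    have := weyl_mem_closedFace hsW hve
    rwa [hs, R.affineReflection_eq_self hv.1] at this
  have hsi : R.ev i (s e) < k := by
    have := R.ev_affineReflection_self i k e
    rw [← hs] at this; linarith
  have key : ∀ a, ⌊R.ev a (s e)⌋ ≠ ⌊R.ev a e⌋ →
      (⌊R.ev a (s e)⌋ - ⌊R.ev a y⌋).natAbs < (⌊R.ev a e⌋ - ⌊R.ev a y⌋).natAbs := by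
    intro a hne
    rcases lt_or_gt_of_ne hne with hlt | hlt
    · set l := ⌊R.ev a e⌋ with hl
      have hle : (l : ℝ) ≤ R.ev a e := Int.floor_le _
      have hls : R.ev a (s e) < l := by
        have h := Int.lt_floor_add_one (R.ev a (s e))
        have : ((⌊R.ev a (s e)⌋ + 1 : ℤ) : ℝ) ≤ l := Int.cast_le.2 (by omega)
        push_cast at this; linarith
      have hvl := R.ev_eq_of_separated hve hvs hle hls.le
      obtain ⟨c, hc, hp⟩ := R.exists_proportional (hv.2 a l hvl)
      have hc : 0 < c := by
        have := hp (s e)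
        by_contra! hneg
        nlinarith
      have hy : ⌊R.ev a y⌋ < l := by
        rw [Int.floor_lt]
        have := hp y
        nlinarith
      have hfl : l - 1 ≤ ⌊R.ev a (s e)⌋ := by
        rw [Int.le_floor]
        by_contra! h
        have := R.le_of_mem_closedFace hvs h.le
        rw [hvl] at this
        push_cast at this
        linarith
      omega
    · set l := ⌊R.ev a (s e)⌋ with hl
      have hle : (l : ℝ) ≤ R.ev a (s e) := Int.floor_le _
      have hls : R.ev a e < l := by
        have h := Int.lt_floor_add_one (R.ev a e)
        have : ((⌊R.ev a e⌋ + 1 : ℤ) : ℝ) ≤ l := Int.cast_le.2 (by omega)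
        push_cast at this; linarith
      have hvl := R.ev_eq_of_separated hvs hve hle hls.le
      obtain ⟨c, hc, hp⟩ := R.exists_proportional (hv.2 a l hvl)
      have hc : c < 0 := by
        have := hp e
        by_contra! hneg
        nlinarith
      have hy : l ≤ ⌊R.ev a y⌋ := by
        rw [Int.le_floor]
        have := hp y
        nlinarith
      have hfl : l - 1 ≤ ⌊R.ev a e⌋ := by
        rw [Int.le_floor]
        by_contra! h
        have := R.le_of_mem_closedFace hve h.le
        rw [hvl] at this
        push_cast at this
        linarith
      omega
  rw [e1]
  refine Finset.sum_lt_sum (fun a _ => ?_) ⟨i, Finset.mem_univ i, key i fun h => ?_⟩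
  · by_cases h : ⌊R.ev a (s e)⌋ = ⌊R.ev a e⌋
    · rw [h]
    · exact (key a h).le
  · have h3 : k ≤ ⌊R.ev i e⌋ := Int.le_floor.2 h1.le
    have h4 : ⌊R.ev i (s e)⌋ < k := Int.floor_lt.2 hsi
    omega

/-- Every point may be moved into the given alcove by reflections at walls of the alcove. -/
lemma exists_mem_closedFace {e : V} (he : R.IsRegularPoint e) (y : V) :
    ∃ u ∈ Subgroup.closure (R.wallReflections e), u y ∈ R.closedFace e := by
  induction hd : R.depth e y using Nat.strong_induction_on generalizing y with
  | _ d ih =>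
    by_cases hy : y ∈ R.closedFace e
    · exact ⟨1, one_mem _, hy⟩
    · obtain ⟨i, k, v, hv, hve, h1, h2⟩ := exists_wall_separating he hy
      obtain ⟨u, hu, huy⟩ := ih _ (hd ▸ depth_affineReflection_lt he hv hve h1 h2) _ rfl
      exact ⟨u * R.affineReflection i k,
        mul_mem hu (Subgroup.subset_closure ⟨i, k, v, hv, hve, rfl⟩), huy⟩

/-- The affine Weyl group acts transitively on the alcoves. -/
lemma exists_weyl_image_eq {e e' : V} (he : R.IsRegularPoint e) (he' : R.IsRegularPoint e') :
    ∃ w ∈ R.affineWeylGroup, w '' R.closedFace e' = R.closedFace e := by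
  obtain ⟨u, hu, h⟩ := exists_mem_closedFace he e'
  have hu := closure_wallReflections_le e hu
  refine ⟨u, hu, ?_⟩
  rw [image_closedFace hu, R.closedFace_eq_of_mem (isRegularPoint_weyl hu he') h]

/-- The affine Weyl group is generated by the reflections at the walls of an alcove. -/
lemma closure_wallReflections {e : V} (he : R.IsRegularPoint e) :
    Subgroup.closure (R.wallReflections e) = R.affineWeylGroup := by
  refine le_antisymm (closure_wallReflections_le e) ?_
  rw [affineWeylGroup, Subgroup.closure_le]
  rintro _ ⟨i, k, rfl⟩
  -- A wall point of the hyperplane is moved into the alcove, which conjugates the reflection to one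
  -- at a wall.
  obtain ⟨v, hv⟩ := R.exists_isWallPoint i k
  obtain ⟨u, hu, hue⟩ := exists_mem_closedFace he v
  have huW := closure_wallReflections_le e hu
  obtain ⟨j, l, hjl, hconj⟩ := weyl_conj_affineReflection (inv_mem huW) i k
  have hw : R.IsWallPoint j l (u v) := by
    refine isWallPoint_weyl (inv_mem huW) ?_ hjl
    rwa [weyl_inv_apply]
  have : R.affineReflection i k = u⁻¹ * R.affineReflection j l * u := by
    rw [← hconj, inv_inv]; group
  rw [this]
  exact mul_mem (mul_mem (inv_mem hu) (Subgroup.subset_closure ⟨j, l, _, hw, hue, rfl⟩)) hu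

variable [R.IsRootSystem]

/-- The exchange condition. -/
lemma exchange {e : V} (he : R.IsRegularPoint e) (i : ι) (k : ℤ) (L : List (V ≃ᵃ[ℝ] V))
    (hL : ∀ s ∈ L, s ∈ R.wallReflections e)
    (hneg : (R.ev i e - k) * (R.ev i (L.prod e) - k) < 0) :
    ∃ L' : List (V ≃ᵃ[ℝ] V), (∀ s ∈ L', s ∈ R.wallReflections e) ∧ L'.length + 1 = L.length ∧
      R.affineReflection i k * L.prod = L'.prod := by
  induction L using List.reverseRecOn with
  | nil => exact absurd hneg (not_lt.2 (mul_self_nonneg (R.ev i e - k)))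
  | append_singleton L t ih =>
    have hL0 : ∀ s ∈ L, s ∈ R.wallReflections e := fun s hs => hL s (by simp [hs])
    have ht : t ∈ R.wallReflections e := hL t (by simp)
    have hLW : L.prod ∈ R.affineWeylGroup := list_prod_mem fun s hs =>
      closure_wallReflections_le e (Subgroup.subset_closure (hL0 s hs))
    rw [List.prod_append, List.prod_singleton] at hneg ⊢
    -- Either the hyperplane already separates `e` from `L.prod e`, and induction applies, or it
    -- separates `L.prod e` from `L.prod (t e)`. In the latter case `L.prod` carries the wall of `t`
    -- to it, and the reflection cancels the last letter.
    rcases lt_or_ge ((R.ev i e - k) * (R.ev i (L.prod e) - k)) 0 with h | h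
    · obtain ⟨L', h1, h2, h3⟩ := ih hL0 h
      refine ⟨L' ++ [t], ?_, by simp [← h2], ?_⟩
      · intro s hs
        rcases List.mem_append.1 hs with hs | hs
        · exact h1 s hs
        · rw [List.mem_singleton.1 hs]; exact ht
      · rw [List.prod_append, List.prod_singleton, ← mul_assoc, h3]
    · obtain ⟨a, m, v, hv, hve, rfl⟩ := ht
      obtain ⟨j, l, hjl, hconj⟩ := weyl_conj_affineReflection hLW i k
      have hreg : R.ev i (L.prod e) - k ≠ 0 :=
        sub_ne_zero.2 (isRegularPoint_weyl hLW he i k)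
      have hreg' : R.ev i e - k ≠ 0 := sub_ne_zero.2 (he i k)
      have hpos : 0 < (R.ev i e - k) * (R.ev i (L.prod e) - k) :=
        lt_of_le_of_ne h (mul_ne_zero hreg' hreg).symm
      have hsep : (R.ev j e - l) * (R.ev j (R.affineReflection a m e) - l) < 0 := by
        rw [← hjl, ← hjl]
        change _ * (R.ev i ((L.prod * R.affineReflection a m) e) - k) < 0
        by_contra! hcon
        nlinarith [mul_self_pos.2 hreg', mul_nonneg hpos.le hcon, mul_pos hpos (neg_pos.2 hneg)]
      have hvs : v ∈ R.closedFace (R.affineReflection a m e) := by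
        have := weyl_mem_closedFace (R.affineReflection_mem a m) hve
        rwa [R.affineReflection_eq_self hv.1] at this
      have hvl : R.ev j v = l := by
        rcases mul_neg_iff.1 hsep with ⟨h1, h2⟩ | ⟨h1, h2⟩
        · exact R.ev_eq_of_separated hve hvs (by linarith) (by linarith)
        · exact R.ev_eq_of_separated hvs hve (by linarith) (by linarith)
      rw [affineReflection_eq_of_hyperplane_eq (hv.2 j l hvl)] at hconj
      refine ⟨L, hL0, by simp, ?_⟩
      rw [mul_assoc, inv_mul_eq_iff_eq_mul] at hconj
      rw [← mul_assoc, hconj, mul_assoc, affineReflection_mul_self, mul_one]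

/-- Alcoves are strict fundamental domains for the affine Weyl group. -/
lemma weyl_eq_self {e x : V} (he : R.IsRegularPoint e) {w : V ≃ᵃ[ℝ] V}
    (hw : w ∈ R.affineWeylGroup) (hx : x ∈ R.closedFace e) (hwx : w x ∈ R.closedFace e) :
    w x = x := by
  obtain ⟨L, hL, rfl⟩ : ∃ L : List (V ≃ᵃ[ℝ] V), (∀ s ∈ L, s ∈ R.wallReflections e) ∧
      L.prod = w := by
    rw [← closure_wallReflections he, ← Subgroup.mem_toSubmonoid,
      Subgroup.closure_toSubmonoid] at hw
    obtain ⟨L, hL, h⟩ := Submonoid.exists_list_of_mem_closure hw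
    refine ⟨L, fun s hs => ?_, h⟩
    rcases hL s hs with h | h
    · exact h
    · obtain ⟨i, k, v, hv, hve, h⟩ := h
      refine ⟨i, k, v, hv, hve, ?_⟩
      rw [← affineReflection_inv, ← h, inv_inv]
  clear hw
  induction hn : L.length using Nat.strong_induction_on generalizing L with
  | _ n ih =>
    cases L with
    | nil => rfl
    | cons s L =>
      have hL0 : ∀ t ∈ L, t ∈ R.wallReflections e := fun t ht => hL t (by simp [ht])
      obtain ⟨i, k, v, hv, hve, rfl⟩ := hL s (by simp)
      have hLW : L.prod ∈ R.affineWeylGroup := list_prod_mem fun s hs =>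
        closure_wallReflections_le e (Subgroup.subset_closure (hL0 s hs))
      rw [List.prod_cons] at hwx ⊢
      rw [List.length_cons] at hn
      set s := R.affineReflection i k with hs
      have hW : s * L.prod ∈ R.affineWeylGroup := mul_mem (R.affineReflection_mem i k) hLW
      have hr := R.ev_affineReflection_self i k (L.prod e)
      rw [← hs] at hr
      change R.ev i ((s * L.prod) e) - k = _ at hr
      have hreg : R.ev i (L.prod e) - k ≠ 0 :=
        sub_ne_zero.2 (isRegularPoint_weyl hLW he i k)
      have hreg' : R.ev i e - k ≠ 0 := sub_ne_zero.2 (he i k)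
      -- If the wall of `s` separates `e` from `L.prod e`, exchange shortens the word. Otherwise it
      -- separates `e` from `s (L.prod e)`; the image of `x` lies in both of these alcoves, hence on
      -- the wall, and the letter `s` may be dropped.
      rcases lt_or_gt_of_ne (mul_ne_zero hreg' hreg) with h | h
      · obtain ⟨L', h1, h2, h3⟩ := exchange he i k L hL0 h
        rw [h3] at hwx ⊢
        exact ih _ (by omega) L' h1 hwx rfl
      · have hmem : (s * L.prod) x ∈ R.closedFace ((s * L.prod) e) := weyl_mem_closedFace hW hx
        have hev : R.ev i ((s * L.prod) x) = k := by
          rcases mul_pos_iff.1 h with ⟨h1, h2⟩ | ⟨h1, h2⟩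
          · exact R.ev_eq_of_separated hwx hmem (by linarith) (by linarith)
          · exact R.ev_eq_of_separated hmem hwx (by linarith) (by linarith)
        have hfix : (s * L.prod) x = L.prod x := by
          have h1 := R.affineReflection_eq_self hev
          rw [← hs] at h1
          change s (s (L.prod x)) = _ at h1
          rw [← h1, hs, affineReflection_affineReflection]
        rw [hfix] at hwx ⊢
        exact ih _ (by omega) L hL0 hwx rfl

end FundamentalDomain

end RootPairing

namespace RootPairing

/-! ### Weyl chambers -/

section Cones

variable {ι V N : Type*} [AddCommGroup V] [Module ℝ V] [AddCommGroup N] [Module ℝ N]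
  {R : RootPairing ι ℝ V N}

/-- The root basis consisting of the negatives of the simple roots. -/
def Base.opp (b : R.Base) : R.Base where
  support := b.support.map R.negIndex
  linearIndepOn_root := by
    rw [Finset.coe_map]
    refine LinearIndepOn.image_of_comp R.negIndex R.root ?_
    have : R.root ∘ R.negIndex = -R.root := funext R.root_negIndex
    exact this ▸ LinearIndependent.neg b.linearIndepOn_root
  linearIndepOn_coroot := by
    rw [Finset.coe_map]
    refine LinearIndepOn.image_of_comp R.negIndex R.coroot ?_
    have : R.coroot ∘ R.negIndex = -R.coroot := funext R.coroot_negIndex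
    exact this ▸ LinearIndependent.neg b.linearIndepOn_coroot
  root_mem_or_neg_mem i := by
    have : R.root '' (b.support.map R.negIndex : Finset ι) = -(R.root '' b.support) := by
      rw [Finset.coe_map, Set.image_image, ← Set.image_neg_eq_neg, Set.image_image]
      exact Set.image_congr fun i _ => R.root_negIndex i
    rw [this, AddSubmonoid.closure_neg, AddSubmonoid.mem_neg, AddSubmonoid.mem_neg, neg_neg]
    exact (b.root_mem_or_neg_mem i).symm
  coroot_mem_or_neg_mem i := by
    have : R.coroot '' (b.support.map R.negIndex : Finset ι) = -(R.coroot '' b.support) := by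
      rw [Finset.coe_map, Set.image_image, ← Set.image_neg_eq_neg, Set.image_image]
      exact Set.image_congr fun i _ => R.coroot_negIndex i
    rw [this, AddSubmonoid.closure_neg, AddSubmonoid.mem_neg, AddSubmonoid.mem_neg, neg_neg]
    exact (b.coroot_mem_or_neg_mem i).symm

lemma mem_weylChamber {b : R.Base} {v x : V} :
    x ∈ weylChamber b v ↔ ∀ i ∈ b.support, 0 ≤ R.ev i (x - v) := Iff.rfl

lemma mem_oppWeylChamber {b : R.Base} {v x : V} :
    x ∈ oppWeylChamber b v ↔ ∀ i ∈ b.support, R.ev i (x - v) ≤ 0 := Iff.rfl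

lemma weylChamber_opp (b : R.Base) (v : V) : weylChamber b.opp v = oppWeylChamber b v := by
  ext x
  simp only [mem_weylChamber, mem_oppWeylChamber, Base.opp, Finset.mem_map,
    forall_exists_index, and_imp, forall_apply_eq_imp_iff₂, ev_negIndex, Left.nonneg_neg_iff]

/-- The fundamental coweight sum: all simple coroots take the value one. -/
lemma exists_ev_eq_one [R.IsRootSystem] (b : R.Base) :
    ∃ u : V, (∀ i ∈ b.support, R.ev i u = 1) ∧ ∀ i, ∃ m : ℤ, R.ev i u = m := by
  obtain ⟨u, hu⟩ := (LinearMap.IsPerfPair.bijective_left (p := R.toLinearMap)).2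
    (b.toCoweightBasis.constr ℝ fun _ => (1 : ℝ))
  have h1 : ∀ i ∈ b.support, R.ev i u = 1 := fun i hi => by
    change R.toLinearMap u (R.coroot i) = 1
    rw [hu]
    have := b.toCoweightBasis.constr_basis ℝ (fun _ => (1 : ℝ)) ⟨i, hi⟩
    rwa [Base.toCoweightBasis_apply] at this
  refine ⟨u, h1, fun i => ?_⟩
  have := b.coroot_mem_span_int i
  change ∃ m : ℤ, R.toLinearMap u (R.coroot i) = m
  generalize R.coroot i = x at this
  induction this using Submodule.span_induction with
  | mem x hx =>
    obtain ⟨j, hj, rfl⟩ := hx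
    exact ⟨1, by push_cast; exact h1 j hj⟩
  | zero => exact ⟨0, by simp⟩
  | add x y _ _ hx hy =>
    obtain ⟨m, hm⟩ := hx
    obtain ⟨n, hn⟩ := hy
    exact ⟨m + n, by rw [map_add, hm, hn]; push_cast; rfl⟩
  | smul a x _ hx =>
    obtain ⟨m, hm⟩ := hx
    exact ⟨a * m, by rw [map_zsmul, hm]; push_cast; simp⟩

lemma abs_ev_le [Fintype ι] (i : ι) (x : V) : |R.ev i x| ≤ ‖R.toE x‖ := by
  rw [← toE_apply, ← Real.norm_eq_abs]
  exact PiLp.norm_apply_le _ i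

lemma add_mem_weylChamber {b : R.Base} {x u : V} :
    x + u ∈ weylChamber b x ↔ u ∈ weylChamber b 0 := by
  simp only [mem_weylChamber, add_sub_cancel_left, sub_zero]

lemma sub_mem_oppWeylChamber {b : R.Base} {x u : V} :
    x - u ∈ oppWeylChamber b x ↔ u ∈ weylChamber b 0 := by
  simp only [mem_weylChamber, mem_oppWeylChamber, sub_sub_cancel_left, map_neg, sub_zero,
    Left.neg_nonpos_iff]

lemma smul_mem_weylChamber {b : R.Base} {u : V} (hu : u ∈ weylChamber b 0) {s : ℝ} (hs : 0 ≤ s) :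
    s • u ∈ weylChamber b 0 := by
  simp only [mem_weylChamber, sub_zero, map_smul, smul_eq_mul] at hu ⊢
  exact fun i hi => mul_nonneg hs (hu i hi)

lemma absorbs_weylChamber (b : R.Base) {u : V} (hu : ∀ i ∈ b.support, 0 < R.ev i u) (v : V) :
    Absorbs (weylChamber b v) (v + u) := by
  intro x
  simp only [mem_weylChamber]
  refine (Finset.eventually_all b.support).2 fun i hi => ?_
  filter_upwards [(R.tendsto_ev i u x).eventually (lt_mem_nhds (hu i hi))] with s hs
  rw [show v + u + s • x - v = u + s • x by abel]
  exact hs.le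

lemma exists_absorbs_weylChamber [R.IsRootSystem] (b : R.Base) (v : V) :
    ∃ p, Absorbs (weylChamber b v) p := by
  obtain ⟨u, hu, -⟩ := exists_ev_eq_one b
  exact ⟨_, absorbs_weylChamber b (fun i hi => (hu i hi).symm ▸ one_pos) v⟩

variable (R) in
lemma exists_isRegularPoint [Finite ι] : ∃ e, R.IsRegularPoint e := by
  obtain ⟨u, hu⟩ := Module.Dual.exists_forall_ne_zero_of_forall_exists R.ev
    fun i => ⟨R.root i, by rw [ev_root_self]; exact two_ne_zero⟩
  obtain ⟨s, hs⟩ := (eventually_all.2 fun i => eventually_forall_int_ne 0 (hu i)).exists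
  refine ⟨s • u, R.isRegularPoint_iff.2 fun i k hk => hs i k ?_⟩
  rw [← hk, map_smul, smul_eq_mul, zero_add]

/-- Translations on which all coroots are integral preserve the arrangement. They serve to push an
alcove deep into a chamber. -/
lemma isRegularPoint_add {e u : V} (he : R.IsRegularPoint e) (hu : ∀ i, ∃ m : ℤ, R.ev i u = m) :
    R.IsRegularPoint (e + u) := by
  rw [isRegularPoint_iff] at he ⊢
  intro i k hk
  obtain ⟨m, hm⟩ := hu i
  refine he i (k - m) ?_
  rw [map_add, hm] at hk
  push_cast; linarith

/-- A Weyl chamber has an interior point in the sense of `Absorbs`, so the condition can be tested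
in the direction `a` itself. -/
lemma eq_zero_of_inner_eq_zero [Fintype ι] [R.IsRootSystem] (b : R.Base) {a : V}
    (h : ∀ u ∈ weylChamber b 0, inner ℝ (R.toE a) (R.toE u) = 0) : a = 0 := by
  obtain ⟨p, hp⟩ := exists_absorbs_weylChamber b 0
  obtain ⟨s, hs, hs0⟩ := ((hp a).and self_mem_nhdsWithin).exists
  obtain ⟨s', hs'⟩ := (hp 0).exists
  have hs0 : 0 < s := hs0
  have h1 := h _ hs
  have h2 := h _ hs'
  rw [smul_zero, add_zero] at h2
  rw [map_add, map_smul, inner_add_right, h2, zero_add, inner_smul_right, mul_eq_zero,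
    or_iff_right hs0.ne', inner_self_eq_zero] at h1
  exact R.toE_injective (h1.trans (map_zero _).symm)

end Cones

end RootPairing

/-! ### Comparing distances along rays -/

section Asymptotics

lemma nonneg_of_quadratic_nonneg {a b c : ℝ} (h : ∀ s : ℝ, 0 ≤ s → 0 ≤ a + s * b + s ^ 2 * c) :
    0 ≤ c ∧ (c = 0 → 0 ≤ b) := by
  constructor
  · by_contra! hc
    have hs : 0 ≤ (|a| + |b| + 1) / (-c) := by
      apply div_nonneg <;> [positivity; linarith]
    have h1 := h ((|a| + |b| + 1) / (-c) + 1) (by linarith)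
    have h2 : (|a| + |b| + 1) / (-c) * c = -(|a| + |b| + 1) := by
      field_simp [hc.ne]
    set s := (|a| + |b| + 1) / (-c)
    have h3 : (s + 1) ^ 2 * c ≤ (s + 1) * (-(|a| + |b| + 1)) := by nlinarith
    nlinarith [le_abs_self a, le_abs_self b, abs_nonneg a, abs_nonneg b]
  · rintro rfl
    by_contra! hb
    have hs : 0 ≤ |a| / (-b) := div_nonneg (abs_nonneg a) (by linarith)
    have h1 := h (|a| / (-b) + 1) (by linarith)
    have h2 : |a| / (-b) * b = -|a| := by field_simp [hb.ne]
    nlinarith [le_abs_self a]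

variable {E : Type*} [NormedAddCommGroup E]

lemma norm_le_norm_congr {a a' b b' : E} (h : ‖a'‖ ≤ ‖b'‖) (ha : a = a') (hb : b = b') :
    ‖a‖ ≤ ‖b‖ := by rwa [ha, hb]

variable [InnerProductSpace ℝ E]

lemma norm_add_smul_sq (a p : E) (s : ℝ) :
    ‖a + s • p‖ ^ 2 = ‖a‖ ^ 2 + s * (2 * inner ℝ a p) + s ^ 2 * ‖p‖ ^ 2 := by
  rw [norm_add_sq_real, inner_smul_right, norm_smul, mul_pow, Real.norm_eq_abs, sq_abs]
  ring

/-- Comparison of the coefficients of `s ^ 2` in the squared norms. -/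
lemma norm_le_of_norm_add_smul_le {a b p q : E}
    (h : ∀ s : ℝ, 0 ≤ s → ‖a + s • p‖ ≤ ‖b + s • q‖) : ‖p‖ ≤ ‖q‖ := by
  have := nonneg_of_quadratic_nonneg (a := ‖b‖ ^ 2 - ‖a‖ ^ 2)
    (b := 2 * inner ℝ b q - 2 * inner ℝ a p) (c := ‖q‖ ^ 2 - ‖p‖ ^ 2) fun s hs => by
      have := pow_le_pow_left₀ (norm_nonneg _) (h s hs) 2
      rw [norm_add_smul_sq, norm_add_smul_sq] at this
      linarith
  exact (sq_le_sq₀ (norm_nonneg _) (norm_nonneg _)).1 (by linarith [this.1])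

/-- With equal speeds the quadratic terms cancel, and the linear terms decide for large `s`. -/
lemma inner_le_of_norm_add_smul_le {a b p : E}
    (h : ∀ s : ℝ, 0 ≤ s → ‖a + s • p‖ ≤ ‖b + s • p‖) : inner ℝ a p ≤ inner ℝ b p := by
  have := nonneg_of_quadratic_nonneg (a := ‖b‖ ^ 2 - ‖a‖ ^ 2)
    (b := 2 * inner ℝ b p - 2 * inner ℝ a p) (c := 0) fun s hs => by
      have := pow_le_pow_left₀ (norm_nonneg _) (h s hs) 2
      rw [norm_add_smul_sq, norm_add_smul_sq] at this
      linarith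
  linarith [this.2 rfl]

end Asymptotics

namespace AffineBuilding

open RootPairing

/-! ### Charts and retractions centered at an alcove -/

section Charts

variable {ι V N X : Type*} [AddCommGroup V] [Module ℝ V] [AddCommGroup N] [Module ℝ N]
  {R : RootPairing ι ℝ V N} {B : AffineBuilding R X}

/-- The points of a chart lying in another apartment form a `W`-convex set. -/
lemma mem_range_of_hull {f g : V → X} (hf : f ∈ B.charts) (hg : g ∈ B.charts) {S : Set V} {x : V}
    (hS : ∀ y ∈ S, f y ∈ Set.range g)
    (h : ∀ (i : ι) (k : ℤ), (∀ y ∈ S, (k : ℝ) ≤ R.ev i y) → (k : ℝ) ≤ R.ev i x) :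
    f x ∈ Set.range g := by
  obtain ⟨s, hs⟩ := B.convex f hf g hg
  change x ∈ f ⁻¹' Set.range g
  rw [hs]
  simp only [Set.mem_iInter]
  intro p hp
  refine h p.1 p.2 fun y hy => ?_
  have : y ∈ f ⁻¹' Set.range g := hS y hy
  rw [hs] at this
  simp only [Set.mem_iInter] at this
  exact this p hp

lemma mem_range_of_closedFace {f g : V → X} (hf : f ∈ B.charts) (hg : g ∈ B.charts) {e x : V}
    (he : f e ∈ Set.range g) (hx : x ∈ R.closedFace e) : f x ∈ Set.range g :=
  mem_range_of_hull hf hg (S := {e}) (by simpa using he) fun i k hk =>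
    hx i k (hk e rfl)

/-- A chart may be changed by an element of the affine Weyl group so that it agrees with a given
chart on the intersection of the apartments. -/
lemma exists_chart_agree {h g : V → X} (hh : h ∈ B.charts) (hg : g ∈ B.charts) :
    ∃ g' ∈ B.charts, Set.range g' = Set.range g ∧ ∀ v, h v ∈ Set.range g → g' v = h v := by
  obtain ⟨w, hw, hwv⟩ := B.transition h hh g hg
  exact ⟨g ∘ w, B.comp_mem g hg w hw, by rw [Set.range_comp, w.surjective.range_eq, Set.image_univ],
    fun v hv => (hwv v hv).symm⟩

/-- Charts that agree on a large set agree wherever they meet. -/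
lemma eq_of_agree {g g' : V → X} (hg : g ∈ B.charts) (hg' : g' ∈ B.charts) {U : Set V} {p : V}
    (hU : Absorbs U p) (h : ∀ x ∈ U, g x = g' x) {v v' : V} (hv : g v = g' v') : v = v' := by
  obtain ⟨w, -, hwv⟩ := B.transition g hg g' hg'
  have : w = 1 := hU.affine_ext fun x hx => by
    have h1 := hwv x ⟨x, (h x hx).symm⟩
    rw [h x hx] at h1
    exact (B.injective g' hg' h1).symm
  have h1 := hwv v ⟨v', hv.symm⟩
  rw [hv, this] at h1
  exact (B.injective g' hg' h1).symm

lemma eq_of_agree_of_mem {g g' : V → X} (hg : g ∈ B.charts) (hg' : g' ∈ B.charts) {U : Set V}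
    {p : V} (hU : Absorbs U p) (h : ∀ x ∈ U, g x = g' x) {v : V} (hv : g v ∈ Set.range g') :
    g v = g' v := by
  obtain ⟨v', hv'⟩ := hv
  rw [← hv', eq_of_agree hg hg' hU h hv'.symm]

variable (B)

/-- A map `φ : X → V` such that `h ∘ φ` is the retraction onto the apartment of the chart `h`
centered at the alcove of `z`. -/
structure IsRetractionAt (h : V → X) (z : V) (φ : X → V) : Prop where
  apply_chart : ∀ g ∈ B.charts, (∀ y ∈ R.closedFace z, g y = h y) → ∀ v, φ (g v) = v
  local_weyl : ∀ g ∈ B.charts, ∀ e, ∃ w ∈ R.affineWeylGroup, ∀ v ∈ R.closedFace e, φ (g v) = w v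
  exists_chart : ∀ x, ∃ g ∈ B.charts, (∀ y ∈ R.closedFace z, g y = h y) ∧ g (φ x) = x

/-- `φ x` is the coordinate of `x` in any chart that contains `x` and agrees with `h` on the alcove
of `z`. Two such charts agree on an absorbing set, so the choice does not matter. -/
lemma exists_isRetractionAt [Finite ι] {h : V → X} (hh : h ∈ B.charts) {z : V}
    (hz : R.IsRegularPoint z) : ∃ φ, B.IsRetractionAt h z φ := by
  have hex : ∀ x, ∃ v, ∃ g ∈ B.charts, (∀ y ∈ R.closedFace z, g y = h y) ∧ g v = x := by
    intro x
    obtain ⟨g, hg, hgz, hgx⟩ := B.common (h z) x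
    obtain ⟨g', hg', hr, hag⟩ := exists_chart_agree hh hg
    rw [← hr] at hgx
    obtain ⟨v, hv⟩ := hgx
    exact ⟨v, g', hg', fun y hy => hag y (mem_range_of_closedFace hh hg hgz hy), hv⟩
  choose φ hφ using hex
  have h1 : ∀ g ∈ B.charts, (∀ y ∈ R.closedFace z, g y = h y) → ∀ v, φ (g v) = v := by
    intro g hg hgz v
    obtain ⟨g', hg', hgz', hv⟩ := hφ (g v)
    exact eq_of_agree hg' hg (absorbs_closedFace hz)
      (fun y hy => (hgz' y hy).trans (hgz y hy).symm) hv
  refine ⟨φ, h1, fun g hg e => ?_, hφ⟩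
  obtain ⟨g', hg', hgz', hv⟩ := hφ (g e)
  obtain ⟨w, hw, hwv⟩ := B.transition g hg g' hg'
  refine ⟨w, hw, fun v hv' => ?_⟩
  rw [hwv v (mem_range_of_closedFace hg hg' ⟨_, hv⟩ hv')]
  exact h1 g' hg' hgz' _

end Charts

/-! ### Retractions do not increase distances -/

section Metric

variable {ι V N X : Type*} [AddCommGroup V] [Module ℝ V] [AddCommGroup N] [Module ℝ N]
  {R : RootPairing ι ℝ V N} {B : AffineBuilding R X} [Fintype ι] [R.IsCrystallographic]

/-- Retractions onto an apartment do not increase distances. -/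
lemma IsRetractionAt.norm_le {h : V → X} {z : V} {φ : X → V} (hφ : B.IsRetractionAt h z φ)
    {g : V → X} (hg : g ∈ B.charts) (u v : V) :
    ‖R.toE (φ (g v) - φ (g u))‖ ≤ ‖R.toE (v - u)‖ := by
  set L := ‖R.toE (v - u)‖ with hL
  have hL0 : 0 ≤ L := norm_nonneg _
  let c : ℝ → EuclideanSpace ℝ ι := fun t => R.toE (φ (g (u + t • (v - u))))
  -- On a single closed face the retraction is an element of the affine Weyl group, hence isometric.
  -- Points slightly before or after a point of the segment have that point in their closed face.
  have hface : ∀ p q : V, p ∈ R.closedFace q → ‖R.toE (φ (g q)) - R.toE (φ (g p))‖ =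
      ‖R.toE (q - p)‖ := by
    intro p q hp
    obtain ⟨w, hw, hwv⟩ := hφ.local_weyl g hg q
    rw [hwv p hp, hwv q (R.self_mem_closedFace q), ← map_sub, norm_toE_weyl_sub hw]
  have hright : ∀ t, ∀ᶠ s : ℝ in 𝓝[>] 0, ‖c (t + s) - c t‖ = s * L := by
    intro t
    filter_upwards [eventually_mem_closedFace (R := R) (u + t • (v - u)) (v - u),
      self_mem_nhdsWithin] with s hs hs0
    have hs0 : 0 < s := hs0
    have e1 : u + (t + s) • (v - u) = u + t • (v - u) + s • (v - u) := by module
    simp only [c]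
    rw [e1, hface _ _ hs, add_sub_cancel_left, map_smul, norm_smul, Real.norm_of_nonneg hs0.le]
  have hleft : ∀ t, ∀ᶠ s : ℝ in 𝓝[>] 0, ‖c (t - s) - c t‖ = s * L := by
    intro t
    filter_upwards [eventually_mem_closedFace (R := R) (u + t • (v - u)) (-(v - u)),
      self_mem_nhdsWithin] with s hs hs0
    have hs0 : 0 < s := hs0
    have e1 : u + (t - s) • (v - u) = u + t • (v - u) + s • (-(v - u)) := by module
    simp only [c]
    rw [e1, hface _ _ hs, add_sub_cancel_left, map_smul, norm_smul, Real.norm_of_nonneg hs0.le,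
      map_neg, norm_neg]
  have hcont : Continuous c := by
    rw [continuous_iff_continuousAt]
    intro t
    rw [Metric.continuousAt_iff]
    intro ε hε
    obtain ⟨δ₁, hδ₁, h₁⟩ := mem_nhdsGT_iff_exists_Ioo_subset.1 (hright t)
    obtain ⟨δ₂, hδ₂, h₂⟩ := mem_nhdsGT_iff_exists_Ioo_subset.1 (hleft t)
    have hδ₁ : 0 < δ₁ := hδ₁
    have hδ₂ : 0 < δ₂ := hδ₂
    refine ⟨min (min δ₁ δ₂) (ε / (L + 1)), by positivity, fun {x} hx => ?_⟩
    rw [Real.dist_eq, lt_min_iff, lt_min_iff] at hx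
    obtain ⟨⟨hx1, hx2⟩, hx3⟩ := hx
    rw [lt_div_iff₀ (by positivity)] at hx3
    rw [dist_eq_norm]
    rcases lt_trichotomy x t with hlt | rfl | hlt
    · rw [abs_of_neg (by linarith)] at hx1 hx2 hx3
      have := h₂ (show t - x ∈ Set.Ioo 0 δ₂ from ⟨by linarith, by linarith⟩)
      simp only [Set.mem_ofPred_eq, sub_sub_cancel] at this
      rw [this]; nlinarith
    · simpa using hε
    · rw [abs_of_pos (by linarith)] at hx1 hx2 hx3
      have := h₁ (show x - t ∈ Set.Ioo 0 δ₁ from ⟨by linarith, by linarith⟩)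
      simp only [Set.mem_ofPred_eq, add_sub_cancel] at this
      rw [this]; nlinarith
  -- Real induction: the set is closed by continuity of `c`, and the bound extends to the right
  -- because `c` locally moves at speed `L`.
  have key : Set.Icc (0 : ℝ) 1 ⊆ {t | ‖c t - c 0‖ ≤ t * L} := by
    refine IsClosed.Icc_subset_of_forall_exists_gt ?_ (by simp) ?_
    · exact (isClosed_le (by fun_prop) (by fun_prop)).inter isClosed_Icc
    · rintro t ⟨ht, -⟩ y hy
      have hy : t < y := hy
      have ht : ‖c t - c 0‖ ≤ t * L := ht
      obtain ⟨s, hs, hs0, hsy⟩ := ((hright t).and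
        (Ioo_mem_nhdsGT (sub_pos.2 hy))).exists
      refine ⟨t + s, ?_, by linarith, by linarith⟩
      change ‖c (t + s) - c 0‖ ≤ (t + s) * L
      calc ‖c (t + s) - c 0‖ = ‖(c (t + s) - c t) + (c t - c 0)‖ := by congr 1; abel
        _ ≤ s * L + t * L := (norm_add_le _ _).trans (by rw [hs]; gcongr)
        _ = (t + s) * L := by ring
  have := key (Set.right_mem_Icc.2 zero_le_one)
  simpa [c] using this

end Metric

/-! ### Apartments containing a point and a sub-Weyl chamber -/

section Sectors

variable {ι V N X : Type*} [AddCommGroup V] [Module ℝ V] [AddCommGroup N] [Module ℝ N]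
  {R : RootPairing ι ℝ V N} {B : AffineBuilding R X} [Fintype ι] [R.IsCrystallographic]
  [R.IsRootSystem]

/-- Let the charts `h` and `k` agree on a Weyl chamber, let `q` and `k` differ by `w` on an opposite
Weyl chamber, and let `h` and `q` agree at an alcove. Then `w` is the identity. -/
lemma transition_eq_one {h k q : V → X} (hh : h ∈ B.charts) (hk : k ∈ B.charts)
    (hq : q ∈ B.charts) {b : R.Base} {y x' z : V} (hz : R.IsRegularPoint z)
    (hhk : ∀ v ∈ weylChamber b y, k v = h v) {w : V ≃ᵃ[ℝ] V} (hw : w ∈ R.affineWeylGroup)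
    (hqk : ∀ v ∈ oppWeylChamber b x', q v = k (w v))
    (hqh : ∀ v ∈ R.closedFace z, q v = h v) : w = 1 := by
  obtain ⟨φ, hφ⟩ := B.exists_isRetractionAt hh hz
  obtain ⟨u₀, hu₀, hu₀Z⟩ := exists_ev_eq_one b
  -- The retraction onto `h` fixes the chamber shared by `h` and `k` and has coordinates `x' - s •
  -- u` on the opposite rays of `q`, while in the apartment of `k` these rays are moved by `w`.
  have I1 : ∀ u ∈ weylChamber b 0, ∀ s : ℝ, 0 ≤ s →
      ‖R.toE (x' - y) + s • R.toE (-(2 : ℝ) • u)‖ ≤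
        ‖R.toE (w x' - y) + s • (-(R.toE (w.linear u) + R.toE u))‖ := by
    intro u hu s hs
    have hsu := smul_mem_weylChamber hu hs
    have h1 := hφ.norm_le hk (y + s • u) (w (x' - s • u))
    rw [← hqk _ (sub_mem_oppWeylChamber.2 hsu), hφ.apply_chart q hq hqh,
      hhk _ (add_mem_weylChamber.2 hsu), hφ.apply_chart h hh fun _ _ => rfl] at h1
    have h2 : w (x' - s • u) = w x' - s • w.linear u := by
      have := linear_eq_sub w (-(s • u)) x'
      rw [map_neg, map_smul] at this
      rw [sub_eq_add_neg x', sub_eq_iff_eq_add'.1 this.symm]; abel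
    rw [h2] at h1
    refine norm_le_norm_congr h1 ?_ ?_
    · simp only [map_sub, map_add, map_smul]; module
    · simp only [map_sub, map_add, map_smul]; module
  -- Comparison of speeds gives `2 ‖u‖ ≤ ‖w.linear u + u‖`. Since `w.linear` is isometric, the
  -- parallelogram law forces `w.linear u = u`, so on the opposite chamber `w` is a translation.
  have hlin : ∀ u ∈ weylChamber b 0, w.linear u = u := by
    intro u hu
    have h1 := norm_le_of_norm_add_smul_le (I1 u hu)
    rw [map_smul, norm_smul, norm_neg, Real.norm_eq_abs, abs_two, norm_neg] at h1
    have h2 := parallelogram_law_with_norm ℝ (R.toE (w.linear u)) (R.toE u)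
    rw [norm_toE_linear hw] at h2
    have h3 : ‖R.toE (w.linear u) - R.toE u‖ = 0 := by
      have := norm_nonneg (R.toE u)
      nlinarith [norm_nonneg (R.toE (w.linear u) - R.toE u)]
    exact R.toE_injective (sub_eq_zero.1 (norm_eq_zero.1 h3))
  have hwu : ∀ u ∈ weylChamber b 0, w (x' - u) = x' - u + (w x' - x') := by
    intro u hu
    have := linear_eq_sub w (-u) x'
    rw [map_neg, hlin u hu] at this
    rw [sub_eq_add_neg x', sub_eq_iff_eq_add'.1 this.symm]; abel
  -- The summand 1 is needed because the whole closed alcove, not only its regular point, must lie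
  -- in the chamber.
  obtain ⟨z', hz', hzK⟩ : ∃ z', R.IsRegularPoint z' ∧ R.closedFace z' ⊆ weylChamber b y := by
    obtain ⟨n, hn⟩ := exists_nat_ge (‖R.toE (y - z)‖ + 1)
    refine ⟨z + n • u₀, isRegularPoint_add hz fun i => ?_, fun x hx i hi => ?_⟩
    · obtain ⟨m, hm⟩ := hu₀Z i
      exact ⟨n * m, by rw [map_nsmul, hm]; push_cast; simp⟩
    · have h1 := R.mem_closedFace_iff_floor.1 hx i
      rw [map_add, map_nsmul, hu₀ i hi, nsmul_eq_mul, mul_one] at h1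
      have h2 := Int.lt_floor_add_one (R.ev i z + n)
      have h3 := (abs_le.1 (abs_ev_le (R := R) i (y - z))).2
      rw [map_sub] at h3
      change 0 ≤ R.ev i (x - y)
      rw [map_sub]
      linarith
  obtain ⟨φ', hφ'⟩ := B.exists_isRetractionAt hk hz'
  have hzz := R.self_mem_closedFace z
  -- One inequality is the next order term of `I1`. The other comes from the retraction onto `k`
  -- centered at an alcove inside the common chamber, applied to the fixed point `q z = h z` and a
  -- ray of `q`.
  have ha : w x' - x' = 0 := by
    refine eq_zero_of_inner_eq_zero b fun u hu => le_antisymm ?_ ?_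
    · have h1 := inner_le_of_norm_add_smul_le (a := R.toE (x' - y)) (b := R.toE (w x' - y))
        (p := R.toE (-(2 : ℝ) • u)) fun s hs => by
          have := I1 u hu s hs
          rw [hlin u hu] at this
          refine norm_le_norm_congr this rfl ?_
          rw [map_smul]; module
      have h2 : R.toE (w x' - y) = R.toE (x' - y) + R.toE (w x' - x') := by
        rw [← map_add]; congr 1; abel
      rw [h2, inner_add_left, map_smul, inner_smul_right, inner_smul_right] at h1
      linarith
    · have h1 := inner_le_of_norm_add_smul_le (a := R.toE (z - x') - R.toE (w x' - x'))
        (b := R.toE (z - x')) (p := R.toE u) fun s hs => by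
          have hsu := smul_mem_weylChamber hu hs
          have h2 := hφ'.norm_le hq (x' - s • u) z
          rw [hqk _ (sub_mem_oppWeylChamber.2 hsu), hφ'.apply_chart k hk fun _ _ => rfl,
            hqh z hzz, hφ'.apply_chart h hh fun v hv => (hhk v (hzK hv)).symm, hwu _ hsu] at h2
          refine norm_le_norm_congr h2 ?_ ?_
          · simp only [map_sub, map_add, map_smul]; module
          · simp only [map_sub, map_smul]; module
      rw [inner_sub_left] at h1
      linarith
  obtain ⟨p, hp⟩ := exists_absorbs_weylChamber b.opp x'
  refine hp.affine_ext fun v hv => ?_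
  rw [weylChamber_opp] at hv
  have hv' : x' - v ∈ weylChamber b 0 := by
    rw [← sub_mem_oppWeylChamber (x := x'), sub_sub_cancel]; exact hv
  have := hwu _ hv'
  rw [sub_sub_cancel, ha, add_zero] at this
  exact this

/-- Two charts that agree at an alcove cover, together with a third chart sharing opposite Weyl
chambers with them, this alcove. -/
lemma mem_range_of_opposite {h k q : V → X} (hh : h ∈ B.charts) (hk : k ∈ B.charts)
    (hq : q ∈ B.charts) {b : R.Base} {y x' z : V} (hz : R.IsRegularPoint z)
    (hhk : ∀ v ∈ weylChamber b y, k v = h v) (hqk : ∀ v ∈ oppWeylChamber b x', q v = k v)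
    (hqh : q z = h z) : h z ∈ Set.range k := by
  obtain ⟨φ, hφ⟩ := B.exists_isRetractionAt hk hz
  have hkk := hφ.apply_chart k hk fun _ _ => rfl
  -- Rays of `k` shared with `h` bound the displacement in one direction, and rays shared with `q`
  -- bound it in the opposite one. Once `h z` retracts to the center `z`, it must equal `k z`.
  have hm : φ (h z) - z = 0 := by
    refine eq_zero_of_inner_eq_zero b fun u hu => ?_
    have h1 := inner_le_of_norm_add_smul_le (a := R.toE (φ (h z) - y)) (b := R.toE (z - y))
      (p := R.toE (-u)) fun s hs => by
        have hsu := smul_mem_weylChamber hu hs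
        have h2 := hφ.norm_le hh (y + s • u) z
        rw [← hhk _ (add_mem_weylChamber.2 hsu), hkk] at h2
        refine norm_le_norm_congr h2 ?_ ?_
        · simp only [map_sub, map_add, map_smul, map_neg]; module
        · simp only [map_sub, map_add, map_smul, map_neg]; module
    have h2 := inner_le_of_norm_add_smul_le (a := R.toE (φ (h z) - x')) (b := R.toE (z - x'))
      (p := R.toE u) fun s hs => by
        have hsu := smul_mem_weylChamber hu hs
        have h2 := hφ.norm_le hq (x' - s • u) z
        rw [hqk _ (sub_mem_oppWeylChamber.2 hsu), hkk, hqh] at h2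
        refine norm_le_norm_congr h2 ?_ ?_
        · simp only [map_sub, map_smul]; module
        · simp only [map_sub, map_smul]; module
    simp only [map_sub, map_neg, inner_sub_left, inner_neg_right] at h1 h2 ⊢
    linarith
  obtain ⟨g, hg, hgk, hgz⟩ := hφ.exists_chart (h z)
  rw [sub_eq_zero.1 hm] at hgz
  exact ⟨z, by rw [← hgz, hgk z (R.self_mem_closedFace z)]⟩

/-- Every point lies in a common apartment with a sub-Weyl chamber of a given Weyl chamber. -/
theorem exists_chart_weylChamber {h : V → X} (hh : h ∈ B.charts) (b : R.Base) (y₀ : V) (x : X) :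
    ∃ k ∈ B.charts, ∃ y, weylChamber b y ⊆ weylChamber b y₀ ∧
      (∀ v ∈ weylChamber b y, k v = h v) ∧ x ∈ Set.range k := by
  obtain ⟨z₀, hz₀⟩ := R.exists_isRegularPoint
  obtain ⟨u₀, hu₀, hu₀Z⟩ := exists_ev_eq_one b
  obtain ⟨g, hg, ⟨v₀, hv₀⟩, ⟨v₁, hv₁⟩⟩ := B.common x (h z₀)
  obtain ⟨n, hn⟩ := exists_nat_ge ‖R.toE (v₁ - v₀)‖
  -- The point `z` must lie beyond `φ x` in the direction of the chamber, although `φ` depends on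
  -- `z`. The bound `n` is uniform: no retraction onto `h` increases the distance from `x` to `h
  -- z₀`.
  set z := z₀ + n • u₀ with hz_def
  have hz : R.IsRegularPoint z := isRegularPoint_add hz₀ fun i => by
    obtain ⟨m, hm⟩ := hu₀Z i
    exact ⟨n * m, by rw [map_nsmul, hm]; push_cast; simp⟩
  obtain ⟨φ, hφ⟩ := B.exists_isRetractionAt hh hz
  obtain ⟨q, hq, hqh, hqx⟩ := hφ.exists_chart x
  have hv : z - φ x ∈ weylChamber b 0 := by
    have h1 := hφ.norm_le hg v₀ v₁
    rw [hv₀, hv₁, hφ.apply_chart h hh fun _ _ => rfl] at h1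
    intro i hi
    have h2 := (abs_le.1 (abs_ev_le (R := R) i (z₀ - φ x))).1
    change 0 ≤ R.ev i (z - φ x - 0)
    rw [sub_zero, hz_def, add_sub_right_comm, map_add, map_nsmul, hu₀ i hi, nsmul_eq_mul, mul_one]
    linarith
  obtain ⟨k₀, hk₀, y, x', hy, -, hyk, hxk⟩ := B.sectors h hh q hq b b.opp y₀ z₀
  obtain ⟨k, hk, hr, hkh⟩ := exists_chart_agree hh hk₀
  rw [← hr] at hyk hxk
  rw [weylChamber_opp] at hxk
  have hhk : ∀ v ∈ weylChamber b y, k v = h v := fun v hv =>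
    hkh v (hr ▸ hyk (Set.mem_image_of_mem h hv))
  obtain ⟨w, hw, hwv⟩ := B.transition q hq k hk
  have hqk : ∀ v ∈ oppWeylChamber b x', q v = k (w v) := fun v hv =>
    hwv v (hxk (Set.mem_image_of_mem q hv))
  have hw1 := transition_eq_one hh hk hq hz hhk hw hqk hqh
  rw [hw1] at hqk
  have hzz := hqh z (R.self_mem_closedFace z)
  have hzk := mem_range_of_opposite hh hk hq hz hhk hqk hzz
  refine ⟨k, hk, y, hy, hhk, ?_⟩
  rw [← hqx]
  -- `φ x` lies in the hull of `z` and the opposite chamber: a half space containing that chamber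
  -- can only gain when moving from `z` by `-(z - φ x)`.
  refine mem_range_of_hull hq hk (S := insert z (oppWeylChamber b x')) ?_ fun i m hm => ?_
  · rintro v (rfl | hv)
    · rw [hzz]; exact hzk
    · exact hxk (Set.mem_image_of_mem q hv)
  · have h1 := hm z (Set.mem_insert _ _)
    have h2 : ∀ s : ℝ, 0 ≤ s → (m : ℝ) ≤ R.ev i x' - s * R.ev i (z - φ x) := fun s hs => by
      have := hm _ (Set.mem_insert_of_mem _
        (sub_mem_oppWeylChamber (x := x').2 (smul_mem_weylChamber hv hs)))
      rwa [map_sub, map_smul, smul_eq_mul] at this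
    have h3 : R.ev i (z - φ x) ≤ 0 := by
      have := (nonneg_of_quadratic_nonneg (a := R.ev i x' - m) (b := -R.ev i (z - φ x)) (c := 0)
        fun s hs => by linarith [h2 s hs]).2 rfl
      linarith
    rw [map_sub] at h3
    linarith

end Sectors

end AffineBuilding

namespace AffineBuilding

open RootPairing

/-! ### Faces and types in different charts -/

section Faces

variable {ι V N X : Type*} [AddCommGroup V] [Module ℝ V] [AddCommGroup N] [Module ℝ N]
  {R : RootPairing ι ℝ V N} {B : AffineBuilding R X}

lemma isAlcove_image {f : V → X} (hf : f ∈ B.charts) {e : V} (he : R.IsRegularPoint e) :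
    B.IsAlcove (f '' R.closedFace e) := ⟨f, hf, _, ⟨e, he, rfl⟩, rfl⟩

lemma isPanel_image {f : V → X} (hf : f ∈ B.charts) {v : V} {i : ι} {k : ℤ}
    (hv : R.IsWallPoint i k v) : B.IsPanel (f '' R.closedFace v) :=
  ⟨f, hf, _, R.isPanel_iff.2 ⟨v, i, k, hv, rfl⟩, rfl⟩

variable [R.IsCrystallographic]

lemma exists_weyl_image_closedFace {f g : V → X} (hf : f ∈ B.charts) (hg : g ∈ B.charts) {e : V}
    (he : f e ∈ Set.range g) :
    ∃ w ∈ R.affineWeylGroup, f e = g (w e) ∧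
      f '' R.closedFace e = g '' R.closedFace (w e) := by
  obtain ⟨w, hw, hwv⟩ := B.transition f hf g hg
  refine ⟨w, hw, hwv e he, ?_⟩
  rw [← image_closedFace hw, Set.image_image]
  exact Set.image_congr fun x hx => hwv x (mem_range_of_closedFace hf hg he hx)

/-- The point `x` is the image of a regular point, so an apartment containing it contains the whole
alcove by convexity. -/
lemma IsAlcove.exists_chart {c : Set X} (hc : B.IsAlcove c) : ∃ x ∈ c, ∀ g ∈ B.charts,
    x ∈ Set.range g → ∃ e, R.IsRegularPoint e ∧ c = g '' R.closedFace e ∧ g e = x := by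
  obtain ⟨f, hf, _, ⟨e, he, rfl⟩, rfl⟩ := hc
  refine ⟨f e, Set.mem_image_of_mem f (R.self_mem_closedFace e), fun g hg hx => ?_⟩
  obtain ⟨w, hw, h1, h2⟩ := exists_weyl_image_closedFace hf hg hx
  exact ⟨w e, isRegularPoint_weyl hw he, h2, h1.symm⟩

lemma IsAlcove.eq_image {c : Set X} (hc : B.IsAlcove c) {g : V → X} (hg : g ∈ B.charts)
    (hcg : c ⊆ Set.range g) : ∃ e, R.IsRegularPoint e ∧ c = g '' R.closedFace e := by
  obtain ⟨x, hx, h⟩ := hc.exists_chart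
  obtain ⟨e, he, hce, -⟩ := h g hg (hcg hx)
  exact ⟨e, he, hce⟩

lemma IsPanel.eq_image {p : Set X} (hp : B.IsPanel p) {g : V → X} (hg : g ∈ B.charts)
    (hpg : p ⊆ Set.range g) : ∃ v i k, R.IsWallPoint i k v ∧ p = g '' R.closedFace v := by
  obtain ⟨f, hf, _, hF, rfl⟩ := hp
  obtain ⟨v, i, k, hv, rfl⟩ := R.isPanel_iff.1 hF
  obtain ⟨w, hw, -, h2⟩ := exists_weyl_image_closedFace hf hg
    (hpg (Set.mem_image_of_mem f (R.self_mem_closedFace v)))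
  obtain ⟨j, l, hjl, -⟩ := weyl_conj_affineReflection (inv_mem hw) i k
  refine ⟨w v, j, l, isWallPoint_weyl (inv_mem hw) ?_ hjl, h2⟩
  rwa [weyl_inv_apply]

lemma isVertex_of_eq {f g : V → X} (hf : f ∈ B.charts) (hg : g ∈ B.charts) {v : V}
    (h : B.IsVertex (f v)) : B.IsVertex (g v) := by
  obtain ⟨f₁, hf₁, v₁, hv₁, heq⟩ := h
  refine ⟨g, hg, v, ?_, rfl⟩
  obtain ⟨w, hw, h1, h2⟩ := exists_weyl_image_closedFace hf₁ hf (e := v₁) ⟨v, heq⟩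
  have hwv : w v₁ = v := B.injective f hf (h1.symm.trans heq.symm)
  change R.closedFace v₁ = {v₁} at hv₁
  change R.closedFace v = {v}
  rw [← hwv, ← image_closedFace hw, hv₁, Set.image_singleton]

omit [R.IsCrystallographic] in
lemma faceType_image {g : V → X} (hg : g ∈ B.charts) (P : Set V) :
    B.faceType (g '' P) = {D | ∃ w ∈ R.affineWeylGroup, w '' D = P} := by
  ext D
  constructor
  · rintro ⟨f, hf, h⟩
    obtain ⟨w, hw, hwv⟩ := B.transition f hf g hg
    refine ⟨w, hw, (B.injective g hg).image_injective ?_⟩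
    rw [← h, Set.image_image]
    refine Set.image_congr fun x hx => (hwv x ?_).symm
    have : f x ∈ g '' P := h ▸ Set.mem_image_of_mem f hx
    exact Set.image_subset_range _ _ this
  · rintro ⟨w, hw, rfl⟩
    exact ⟨g ∘ w, B.comp_mem g hg w hw, Set.image_comp _ _ _⟩

omit [R.IsCrystallographic] in
lemma faceType_image_eq {f g : V → X} (hf : f ∈ B.charts) (hg : g ∈ B.charts) (P : Set V) :
    B.faceType (f '' P) = B.faceType (g '' P) := by
  rw [faceType_image hf, faceType_image hg]

end Faces

/-! ### Charts centered at the opposite chamber -/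

section Centered

variable {ι V N X : Type*} [AddCommGroup V] [Module ℝ V] [AddCommGroup N] [Module ℝ N]
  {R : RootPairing ι ℝ V N} (B : AffineBuilding R X)

/-- The chart `g` agrees with `f` on a sub-Weyl chamber of `oppWeylChamber b o`. -/
def IsCentered (f : V → X) (b : R.Base) (o : V) (g : V → X) : Prop :=
  g ∈ B.charts ∧ ∃ u, oppWeylChamber b u ⊆ oppWeylChamber b o ∧ ∀ v ∈ oppWeylChamber b u, g v = f v

variable {B} {f : V → X} {b : R.Base} {o : V}

lemma isCentered_self (hf : f ∈ B.charts) : B.IsCentered f b o f :=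
  ⟨hf, o, subset_rfl, fun _ _ => rfl⟩

variable [Fintype ι] [R.IsRootSystem]

/-- The Weyl element in the definition of `ρ` fixes a sub-Weyl chamber pointwise, hence is the
identity. -/
lemma IsOppRetraction.apply_of_isCentered {ρ : X → X} (hρ : B.IsOppRetraction f b o ρ)
    (hf : f ∈ B.charts) {g : V → X} (hg : B.IsCentered f b o g) (v : V) : ρ (g v) = f v := by
  obtain ⟨hgc, u, hu, hgf⟩ := hg
  obtain ⟨⟨w, -, hwv⟩, hfix⟩ := hρ.isomorphism g hgc
    ⟨u, hu, by rintro _ ⟨x, hx, rfl⟩; exact ⟨x, hgf x hx⟩⟩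
  obtain ⟨p, hp⟩ := exists_absorbs_weylChamber b.opp u
  rw [weylChamber_opp] at hp
  have hw1 : w = 1 := hp.affine_ext fun x hx => by
    have h1 := hwv x
    rw [hgf x hx, hfix (f x) ⟨⟨x, rfl⟩, ⟨x, hgf x hx⟩⟩] at h1
    exact (B.injective f hf h1).symm
  rw [hwv, hw1]; rfl

lemma exists_oppWeylChamber_subset (b : R.Base) (u₁ u₂ : V) :
    ∃ u, oppWeylChamber b u ⊆ oppWeylChamber b u₁ ∧ oppWeylChamber b u ⊆ oppWeylChamber b u₂ := by
  obtain ⟨u₀, hu₀, -⟩ := exists_ev_eq_one b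
  obtain ⟨n, hn⟩ := exists_nat_ge ‖R.toE (u₁ - u₂)‖
  have h0 : (0 : ℝ) ≤ n := Nat.cast_nonneg n
  refine ⟨u₁ - n • u₀, fun x hx i hi => ?_, fun x hx i hi => ?_⟩
  all_goals
    have h1 := mem_oppWeylChamber.1 hx i hi
    have h2 := (abs_le.1 (abs_ev_le (R := R) i (u₁ - u₂))).2
    rw [map_sub] at h2
    rw [map_sub, map_sub, map_nsmul, hu₀ i hi, nsmul_eq_mul, mul_one] at h1
    change R.ev i (x - _) ≤ 0
    rw [map_sub]
    linarith

lemma IsCentered.exists_agree {g g' : V → X} (hg : B.IsCentered f b o g)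
    (hg' : B.IsCentered f b o g') : ∃ u, ∀ v ∈ oppWeylChamber b u, g v = g' v := by
  obtain ⟨-, u₁, -, h₁⟩ := hg
  obtain ⟨-, u₂, -, h₂⟩ := hg'
  obtain ⟨u, hu₁, hu₂⟩ := exists_oppWeylChamber_subset b u₁ u₂
  exact ⟨u, fun v hv => (h₁ v (hu₁ hv)).trans (h₂ v (hu₂ hv)).symm⟩

lemma IsCentered.eq_of_mem {g g' : V → X} (hg : B.IsCentered f b o g)
    (hg' : B.IsCentered f b o g') {v : V} (hv : g v ∈ Set.range g') : g v = g' v := by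
  obtain ⟨u, hu⟩ := hg.exists_agree hg'
  obtain ⟨p, hp⟩ := exists_absorbs_weylChamber b.opp u
  rw [weylChamber_opp] at hp
  exact eq_of_agree_of_mem hg.1 hg'.1 hp hu hv

lemma exists_isCentered [R.IsCrystallographic] (hf : f ∈ B.charts) (x : X) :
    ∃ g, B.IsCentered f b o g ∧ x ∈ Set.range g := by
  obtain ⟨g, hg, u, hu, hgf, hx⟩ := exists_chart_weylChamber hf b.opp o x
  rw [weylChamber_opp, weylChamber_opp] at hu
  rw [weylChamber_opp] at hgf
  exact ⟨g, ⟨hg, u, hu, hgf⟩, hx⟩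

end Centered

/-! ### Unfolding positively folded galleries -/

section Unfolding

variable {ι V N X : Type*} [AddCommGroup V] [Module ℝ V] [AddCommGroup N] [Module ℝ N]
  {R : RootPairing ι ℝ V N}

lemma IsWallPoint.of_mem {i j : ι} {k l : ℤ} {v : V} (h : R.IsWallPoint i k v)
    (hv : R.ev j v = l) : R.IsWallPoint j l v :=
  ⟨hv, fun a m ha => (h.2 a m ha).trans (h.2 j l hv).symm⟩

lemma ev_nonpos_of_bounded {i : ι} {m : ℝ} {x u : V}
    (h : ∀ s : ℝ, 0 ≤ s → m ≤ R.ev i (x - s • u)) : R.ev i u ≤ 0 := by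
  have := (nonneg_of_quadratic_nonneg (a := R.ev i x - m) (b := -R.ev i u) (c := 0)
    fun s hs => by
      have := h s hs
      rw [map_sub, map_smul, smul_eq_mul] at this
      linarith).2 rfl
  linarith

/-- A half space containing a translate of the opposite chamber has a form that is nonpositive on
dominant directions. The product makes the conclusion independent of the sign of the root. -/
lemma Separates.mul_ev_nonneg {j : ι} {k : ℤ} {b : R.Base} {o e : V}
    (h : R.Separates j k (R.closedFace e) (oppWeylChamber b o)) {u : V}
    (hu : u ∈ weylChamber b 0) : 0 ≤ (R.ev j e - k) * R.ev j u := by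
  obtain ⟨v, ⟨h1, h2⟩ | ⟨h1, h2⟩⟩ := h
  · have he : R.ev j e ≤ k := h2 (R.self_mem_closedFace e)
    have hu : R.ev j u ≤ 0 := ev_nonpos_of_bounded (m := k) (x := v + o) fun s hs => by
      have := h1 (Set.mem_image_of_mem _
        (sub_mem_oppWeylChamber (x := o).2 (smul_mem_weylChamber hu hs)))
      rwa [← add_sub_assoc] at this
    nlinarith
  · have he : (k : ℝ) ≤ R.ev j e := h2 (R.self_mem_closedFace e)
    have hu : R.ev (R.negIndex j) u ≤ 0 :=
      ev_nonpos_of_bounded (m := -k) (x := v + o) fun s hs => by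
        have := h1 (Set.mem_image_of_mem _
          (sub_mem_oppWeylChamber (x := o).2 (smul_mem_weylChamber hu hs)))
        rw [← add_sub_assoc] at this
        have : R.ev j (v + o - s • u) ≤ k := this
        rw [ev_negIndex]; linarith
    rw [ev_negIndex] at hu
    nlinarith

variable {B : AffineBuilding R X} {f : V → X} {b : R.Base} {o : V} [Fintype ι] [R.IsRootSystem]
  [R.IsCrystallographic]

/-- At a panel of an apartment there is an alcove outside of the apartment which the retraction
maps to the alcove of the apartment on the far side of the center. -/
lemma exists_isCentered_fold (hB : B.IsThick) (hf : f ∈ B.charts) {g : V → X}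
    (hg : B.IsCentered f b o g) {e v : V} (he : R.IsRegularPoint e) {i : ι} {k : ℤ}
    (hv : R.IsWallPoint i k v) (hve : v ∈ R.closedFace e)
    (hsep : R.Separates i k (R.closedFace e) (oppWeylChamber b o)) :
    ∃ g', B.IsCentered f b o g' ∧ g' v = g v ∧ g '' R.closedFace e ≠ g' '' R.closedFace e := by
  set s := R.affineReflection i k with hs
  have hsW : s ∈ R.affineWeylGroup := R.affineReflection_mem i k
  have hse : R.IsRegularPoint (s e) := isRegularPoint_weyl hsW he
  have hvs : v ∈ R.closedFace (s e) := by
    have := weyl_mem_closedFace hsW hve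
    rwa [hs, R.affineReflection_eq_self hv.1] at this
  have hsi : R.ev i (s e) - k = -(R.ev i e - k) := R.ev_affineReflection_self i k e
  -- Thickness: a third alcove on the panel, besides the two in the apartment of `g`.
  obtain ⟨c, ⟨hc, hpc⟩, hc1, hc2⟩ : ∃ c ∈ {c | B.IsAlcove c ∧ g '' R.closedFace v ⊆ c},
      c ≠ g '' R.closedFace e ∧ c ≠ g '' R.closedFace (s e) := by
    by_contra! h
    have hsub : {c | B.IsAlcove c ∧ g '' R.closedFace v ⊆ c} ⊆
        {g '' R.closedFace e, g '' R.closedFace (s e)} := fun c hc => by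
      by_cases h1 : c = g '' R.closedFace e
      · exact Or.inl h1
      · exact Or.inr (h c hc h1)
    have h3 := (hB _ (isPanel_image hg.1 hv)).trans
      ((Set.encard_le_encard hsub).trans ((Set.encard_insert_le _ _).trans
        (by rw [Set.encard_singleton])))
    exact absurd h3 (by norm_num)
  obtain ⟨x, hx, hcx⟩ := hc.exists_chart
  obtain ⟨g', hg', hxg'⟩ := exists_isCentered (b := b) (o := o) hf x
  obtain ⟨e₂, he₂, hce₂, -⟩ := hcx g' hg'.1 hxg'
  have hgv : g v ∈ Set.range g' := by
    have := hpc (Set.mem_image_of_mem g (R.self_mem_closedFace v))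
    rw [hce₂] at this
    exact Set.image_subset_range _ _ this
  have hgg' := hg.eq_of_mem hg' hgv
  have hve₂ : v ∈ R.closedFace e₂ := by
    have := hpc (Set.mem_image_of_mem g (R.self_mem_closedFace v))
    rw [hce₂, hgg'] at this
    exact (B.injective g' hg'.1).mem_set_image.1 this
  -- The alcove on the side of the center lies in the hull of the panel point and a remote opposite
  -- chamber. A half space violating this would be bounded by the hyperplane of the panel and face
  -- the far side, so its form would vanish on a whole Weyl chamber.
  have hge : g (s e) ∈ Set.range g' := by
    obtain ⟨u, hu⟩ := hg.exists_agree hg'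
    refine mem_range_of_hull hg.1 hg'.1 (S := insert v (oppWeylChamber b u)) ?_
      fun j l hjl => ?_
    · rintro y (rfl | hy)
      · exact hgv
      · exact ⟨y, (hu y hy).symm⟩
    by_contra! hlt
    obtain ⟨a, ha, hp⟩ := R.exists_proportional
      (R.hyperplane_eq_of_not_mem hv hvs (hjl v (Set.mem_insert _ _)) hlt)
    have ha' : 0 < a * (R.ev i e - k) := by
      have := hp (s e)
      rw [hsi] at this
      linarith
    have hK : ∀ x ∈ weylChamber b 0, R.ev i x = 0 := fun x hx => by
      have h1 : R.ev j x ≤ 0 := ev_nonpos_of_bounded (m := l) (x := u) fun s hs =>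
        hjl _ (Set.mem_insert_of_mem _ (sub_mem_oppWeylChamber.2 (smul_mem_weylChamber hx hs)))
      have h2 : R.ev j x = a * R.ev i x := by
        have h1 := hp x
        have h2 := hp 0
        simp only [map_zero] at h2
        linarith
      have h3 := Separates.mul_ev_nonneg hsep hx
      have h4 : 0 ≤ a * R.ev i x := by
        by_contra! hneg
        nlinarith [mul_self_pos.2 ha]
      have h5 : a * R.ev i x = 0 := le_antisymm (h2 ▸ h1) h4
      exact (mul_eq_zero.1 h5).resolve_left ha
    obtain ⟨p, hp⟩ := exists_absorbs_weylChamber b 0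
    obtain ⟨t, ht, ht0⟩ := ((hp (R.root i)).and self_mem_nhdsWithin).exists
    obtain ⟨t', ht'⟩ := (hp 0).exists
    have ht0 : 0 < t := ht0
    have h1 := hK _ ht
    have h2 := hK _ ht'
    rw [smul_zero, add_zero] at h2
    rw [map_add, h2, map_smul, ev_root_self, smul_eq_mul] at h1
    linarith
  refine ⟨g', hg', hgg'.symm, ?_⟩
  have hne₂ : R.ev i e₂ - k ≠ 0 := sub_ne_zero.2 (he₂ i k)
  have hne : R.ev i e - k ≠ 0 := sub_ne_zero.2 (he i k)
  -- If `c` were on the side of the center in `g'`, it would coincide with `g '' R.closedFace (s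
  -- e)`, which was excluded.
  rcases lt_or_gt_of_ne (mul_ne_zero hne₂ hne) with h | h
  · refine absurd ?_ hc2
    rw [hce₂, R.closedFace_eq_of_sameSide hv hve₂ hvs (by rw [hsi]; linarith)]
    refine Set.image_congr fun x hx => (hg.eq_of_mem hg' ?_).symm
    exact mem_range_of_closedFace hg.1 hg'.1 hge hx
  · rw [← R.closedFace_eq_of_sameSide hv hve₂ hve h, ← hce₂,
      R.closedFace_eq_of_sameSide hv hve₂ hve h]
    exact hc1.symm

/-- A positively folded gallery is the image under the retraction of a gallery of the same type
without folds. -/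
theorem exists_unfolding (hB : B.IsThick) (hf : f ∈ B.charts) {ρ : X → X}
    (hρ : B.IsOppRetraction f b o ρ) {n : ℕ} (γ : B.Gallery n) (hγA : γ.IsIn f)
    (hγ : γ.IsPositivelyFolded f (oppWeylChamber b o)) :
    ∃ σ : B.Gallery n, σ.source = γ.source ∧ σ.type = γ.type ∧ Gallery.MapsTo ρ σ γ ∧
      ∀ i : Fin n, σ.alcove i.castSucc ≠ σ.alcove i.succ := by
  choose e he hC using fun i => (γ.isAlcove i).eq_image hf (hγA i)
  choose v a k hv hP using fun i => (γ.isPanel i).eq_image hf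
    ((γ.panel_subset_left i).trans (hγA _))
  have hmem : ∀ {x y : V}, f '' R.closedFace x ⊆ f '' R.closedFace y → x ∈ R.closedFace y :=
    fun {x y} h => (Set.image_subset_image_iff (B.injective f hf)).1 h (R.self_mem_closedFace x)
  have hvl : ∀ i : Fin n, v i ∈ R.closedFace (e i.castSucc) := fun i =>
    hmem (by rw [← hP, ← hC]; exact γ.panel_subset_left i)
  have hvr : ∀ i : Fin n, v i ∈ R.closedFace (e i.succ) := fun i =>
    hmem (by rw [← hP, ← hC]; exact γ.panel_subset_right i)
  -- Without a fold the current chart already gives distinct alcoves; at a fold a new centered chart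
  -- is needed, which has the same panel point.
  have hstep : ∀ (i : Fin n) (g : {g // B.IsCentered f b o g}),
      ∃ g' : {g // B.IsCentered f b o g}, g'.1 (v i) = g.1 (v i) ∧
        g.1 '' R.closedFace (e i.castSucc) ≠ g'.1 '' R.closedFace (e i.succ) := by
    rintro i ⟨g, hg⟩
    by_cases h : R.closedFace (e i.castSucc) = R.closedFace (e i.succ)
    · obtain ⟨j, l, hjl, hsep⟩ := hγ i (by rw [hC, hC, h])
      rw [hP, Set.preimage_image_eq _ (B.injective f hf)] at hjl
      rw [hC, Set.preimage_image_eq _ (B.injective f hf)] at hsep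
      obtain ⟨g', hg', h1, h2⟩ := exists_isCentered_fold hB hf hg (he i.succ)
        (IsWallPoint.of_mem (hv i) (hjl (R.self_mem_closedFace _))) (hvr i) hsep
      exact ⟨⟨g', hg'⟩, h1, by rwa [h]⟩
    · exact ⟨⟨g, hg⟩, rfl, fun h' => h ((B.injective g hg.1).image_injective h')⟩
  choose step hstep1 hstep2 using hstep
  let G : Fin (n + 1) → {g // B.IsCentered f b o g} :=
    Fin.induction ⟨f, isCentered_self hf⟩ step
  have hG0 : G 0 = ⟨f, isCentered_self hf⟩ := Fin.induction_zero ..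
  have hGs : ∀ i : Fin n, G i.succ = step i (G i.castSucc) := Fin.induction_succ _ _
  obtain ⟨t, ht⟩ : γ.target ∈ Set.range f := hγA _ γ.target_mem
  -- Consecutive charts agree on the closed panel, so the lifted panel is a face of both lifted
  -- alcoves.
  have hcl : ∀ i : Fin n, ∀ x ∈ R.closedFace (v i), (G i.succ).1 x = (G i.castSucc).1 x := by
    intro i x hx
    have h1 : (G i.succ).1 (v i) = (G i.castSucc).1 (v i) := by rw [hGs, hstep1]
    exact (G i.succ).2.eq_of_mem (G i.castSucc).2
      (mem_range_of_closedFace (G i.succ).2.1 (G i.castSucc).2.1 ⟨_, h1.symm⟩ hx)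
  have hρG : ∀ i (D : Set V), ρ '' ((G i).1 '' D) = f '' D := fun i D => by
    rw [Set.image_image]
    exact Set.image_congr fun x _ => hρ.apply_of_isCentered hf (G i).2 x
  have hsrc : γ.source ∈ Set.range f := hγA _ γ.source_mem
  let σ : B.Gallery n :=
    { source := γ.source
      target := (G (Fin.last n)).1 t
      alcove := fun i => (G i).1 '' R.closedFace (e i)
      panel := fun i => (G i.castSucc).1 '' R.closedFace (v i)
      isVertex_source := γ.isVertex_source
      isVertex_target := isVertex_of_eq hf (G _).2.1 (ht ▸ γ.isVertex_target)
      isAlcove := fun i => isAlcove_image (G i).2.1 (he i)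
      isPanel := fun i => isPanel_image (G _).2.1 (hv i)
      source_mem := by
        rw [hG0, ← hC]; exact γ.source_mem
      target_mem := by
        have := γ.target_mem
        rw [hC, ← ht, (B.injective f hf).mem_set_image] at this
        exact Set.mem_image_of_mem _ this
      panel_subset_left := fun i => Set.image_mono (R.closedFace_subset (hvl i))
      panel_subset_right := fun i => by
        rw [← Set.image_congr (hcl i)]
        exact Set.image_mono (R.closedFace_subset (hvr i)) }
  refine ⟨σ, rfl, ?_, ⟨?_, fun i => ?_, fun i => ?_, ?_⟩, fun i => ?_⟩
  · simp only [Gallery.type, σ, Prod.mk.injEq, true_and]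
    refine ⟨funext fun i => ?_, ?_⟩
    · rw [hP]; exact faceType_image_eq (G _).2.1 hf _
    · rw [← ht, ← Set.image_singleton, ← Set.image_singleton]
      exact faceType_image_eq (G _).2.1 hf _
  · obtain ⟨x, hx⟩ := hsrc
    change ρ γ.source = γ.source
    rw [← hx]
    exact hρ.apply_of_isCentered hf (isCentered_self hf) x
  · rw [hC]; exact hρG i _
  · rw [hP]; exact hρG _ _
  · rw [← ht]; exact hρ.apply_of_isCentered hf (G _).2 t
  · change (G i.castSucc).1 '' _ ≠ (G i.succ).1 '' _
    rw [hGs]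
    exact hstep2 i _

end Unfolding

end AffineBuilding

/-! ### Straight galleries in an apartment -/

namespace RootPairing

variable {ι V N : Type*} [AddCommGroup V] [Module ℝ V] [AddCommGroup N] [Module ℝ N]
  (R : RootPairing ι ℝ V N)

/-- The alcoves of `e 0, …, e k` form a gallery with the panels of `v 0, …, v (k - 1)` that does
not cross any hyperplane twice. -/
structure IsStraight (k : ℕ) (e v : ℕ → V) : Prop where
  isRegularPoint : ∀ j ≤ k, R.IsRegularPoint (e j)
  isWallPoint : ∀ j < k, ∃ i l, R.IsWallPoint i l (v j)
  mem_left : ∀ j < k, v j ∈ R.closedFace (e j)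
  mem_right : ∀ j < k, v j ∈ R.closedFace (e (j + 1))
  ne : ∀ j < k, R.closedFace (e j) ≠ R.closedFace (e (j + 1))
  convex : ∀ (i : ι) (l : ℤ) (a c d : ℕ), a ≤ c → c ≤ d → d ≤ k →
    (l : ℝ) ≤ R.ev i (e a) → (l : ℝ) ≤ R.ev i (e d) → (l : ℝ) ≤ R.ev i (e c)

variable {R}

lemma IsStraight.mono {k k' : ℕ} {e v : ℕ → V} (h : R.IsStraight k e v) (hk : k' ≤ k) :
    R.IsStraight k' e v :=
  ⟨fun j hj => h.1 j (hj.trans hk), fun j hj => h.2 j (hj.trans_le hk),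
    fun j hj => h.3 j (hj.trans_le hk), fun j hj => h.4 j (hj.trans_le hk),
    fun j hj => h.5 j (hj.trans_le hk), fun i l a c d h1 h2 h3 => h.6 i l a c d h1 h2 (h3.trans hk)⟩

lemma IsStraight.congr {k : ℕ} {e v e' v' : ℕ → V} (h : R.IsStraight k e v)
    (he : ∀ j ≤ k, e' j = e j) (hv : ∀ j < k, v' j = v j) : R.IsStraight k e' v' where
  isRegularPoint j hj := he j hj ▸ h.1 j hj
  isWallPoint j hj := hv j hj ▸ h.2 j hj
  mem_left j hj := by rw [hv j hj, he j hj.le]; exact h.3 j hj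
  mem_right j hj := by rw [hv j hj, he (j + 1) hj]; exact h.4 j hj
  ne j hj := by rw [he j hj.le, he (j + 1) hj]; exact h.5 j hj
  convex i l a c d h1 h2 h3 := by
    rw [he a ((h1.trans h2).trans h3), he c (h2.trans h3), he d h3]
    exact h.6 i l a c d h1 h2 h3

lemma mul_neg_of_closedFace_ne {e e' v : V} (he : R.IsRegularPoint e) (he' : R.IsRegularPoint e')
    {i : ι} {l : ℤ} (hw : R.IsWallPoint i l v) (hv : v ∈ R.closedFace e)
    (hv' : v ∈ R.closedFace e') (hne : R.closedFace e ≠ R.closedFace e') :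
    (R.ev i e - l) * (R.ev i e' - l) < 0 := by
  refine lt_of_le_of_ne (not_lt.1 fun h => hne (R.closedFace_eq_of_sameSide hw hv hv' h)) ?_
  exact mul_ne_zero (sub_ne_zero.2 (he i l)) (sub_ne_zero.2 (he' i l))

/-- A half space bounded by `H_{α,l}` that contains a point contains all points on the same side. -/
lemma le_ev_of_sameSide {i a : ι} {l m : ℤ} (h : R.affineHyperplane a m = R.affineHyperplane i l)
    {x y : V} (hs : 0 < (R.ev i x - l) * (R.ev i y - l)) (hx : (m : ℝ) ≤ R.ev a x) :
    (m : ℝ) ≤ R.ev a y := by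
  obtain ⟨c, hc, hp⟩ := R.exists_proportional h
  have h1 := hp x
  have h2 := hp y
  by_contra! hlt
  have h3 : 0 ≤ c * (R.ev i x - l) := by linarith
  have h4 : c * (R.ev i y - l) < 0 := by linarith
  nlinarith [mul_pos (mul_self_pos.2 hc) hs, mul_nonneg h3 (neg_pos.2 h4).le]

/-- By `hside` the hyperplane of the new panel has not been crossed before, and it is the only one
separating the last two alcoves; so no half space is left and entered again. -/
lemma IsStraight.succ {k : ℕ} {e v : ℕ → V} (h : R.IsStraight k e v)
    (he : R.IsRegularPoint (e (k + 1))) {i : ι} {l : ℤ} (hv : R.IsWallPoint i l (v k))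
    (hl : v k ∈ R.closedFace (e k)) (hr : v k ∈ R.closedFace (e (k + 1)))
    (hne : R.closedFace (e k) ≠ R.closedFace (e (k + 1)))
    (hside : ∀ j ≤ k, 0 < (R.ev i (e j) - l) * (R.ev i (e k) - l)) : R.IsStraight (k + 1) e v where
  isRegularPoint j hj := by
    rcases Nat.le_succ_iff.1 hj with hj | rfl
    · exact h.1 j hj
    · exact he
  isWallPoint j hj := by
    rcases Nat.lt_succ_iff_lt_or_eq.1 hj with hj | rfl
    · exact h.2 j hj
    · exact ⟨i, l, hv⟩
  mem_left j hj := by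
    rcases Nat.lt_succ_iff_lt_or_eq.1 hj with hj | rfl
    · exact h.3 j hj
    · exact hl
  mem_right j hj := by
    rcases Nat.lt_succ_iff_lt_or_eq.1 hj with hj | rfl
    · exact h.4 j hj
    · exact hr
  ne j hj := by
    rcases Nat.lt_succ_iff_lt_or_eq.1 hj with hj | rfl
    · exact h.5 j hj
    · exact hne
  convex i' m a c d hac hcd hd ha hd' := by
    rcases Nat.le_succ_iff.1 hd with hd | rfl
    · exact h.6 i' m a c d hac hcd hd ha hd'
    rcases Nat.le_succ_iff.1 hcd with hck | rfl
    · by_cases hk : (m : ℝ) ≤ R.ev i' (e k)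
      · exact h.6 i' m a c k hac hck le_rfl ha hk
      · have h1 := hv.2 i' m (R.ev_eq_of_separated hr hl hd' (not_le.1 hk).le)
        exact absurd (le_ev_of_sameSide h1 (hside a (hac.trans hck)) ha) hk
    · exact hd'

lemma IsStraight.sameSide {k : ℕ} {e v : ℕ → V} (h : R.IsStraight (k + 1) e v) {i : ι} {l : ℤ}
    (hv : R.IsWallPoint i l (v k)) (j : ℕ) (hj : j ≤ k) :
    0 < (R.ev i (e j) - l) * (R.ev i (e k) - l) := by
  have hk := k.lt_succ_self
  have hneg := mul_neg_of_closedFace_ne (h.1 k hk.le) (h.1 (k + 1) le_rfl) hv (h.3 k hk)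
    (h.4 k hk) (h.5 k hk)
  have hj0 : R.ev i (e j) - l ≠ 0 := sub_ne_zero.2 (h.1 j (hj.trans hk.le) i l)
  rcases mul_neg_iff.1 hneg with ⟨h1, h2⟩ | ⟨h1, h2⟩
  · refine mul_pos (lt_of_le_of_ne (not_lt.1 fun hlt => ?_) hj0.symm) h1
    have := h.6 (R.negIndex i) (-l) j k (k + 1) hj hk.le le_rfl
      (by rw [ev_negIndex]; push_cast; linarith) (by rw [ev_negIndex]; push_cast; linarith)
    rw [ev_negIndex] at this
    push_cast at this
    linarith
  · refine mul_pos_of_neg_of_neg (lt_of_le_of_ne (not_lt.1 fun hlt => ?_) hj0) h1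
    have := h.6 i l j k (k + 1) hj hk.le le_rfl (by linarith) (by linarith)
    linarith

end RootPairing

namespace AffineBuilding

open RootPairing

/-! ### Chains of alcoves -/

section Linked

variable {ι V N X : Type*} [AddCommGroup V] [Module ℝ V] [AddCommGroup N] [Module ℝ N]
  {R : RootPairing ι ℝ V N} (B : AffineBuilding R X)

/-- Two alcoves are connected by a gallery of alcoves of the given length. -/
inductive Linked : ℕ → Set X → Set X → Prop
  | refl {c : Set X} (hc : B.IsAlcove c) : Linked 0 c c
  | tail {n : ℕ} {c d d' p : Set X} (h : Linked n c d) (hd : B.IsAlcove d') (hp : B.IsPanel p)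
      (hl : p ⊆ d) (hr : p ⊆ d') : Linked (n + 1) c d'

variable {B}

lemma Linked.trans {n m : ℕ} {c d d' : Set X} (h : B.Linked n c d) (h' : B.Linked m d d') :
    B.Linked (n + m) c d' := by
  induction h' with
  | refl => exact h
  | tail _ hd hp hl hr ih => exact (ih h).tail hd hp hl hr

lemma Linked.exists_seq {n : ℕ} {c d : Set X} (h : B.Linked n c d) :
    ∃ A P : ℕ → Set X, A 0 = c ∧ A n = d ∧ (∀ i ≤ n, B.IsAlcove (A i)) ∧
      ∀ i < n, B.IsPanel (P i) ∧ P i ⊆ A i ∧ P i ⊆ A (i + 1) := by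
  induction h with
  | @refl c hc => exact ⟨fun _ => c, fun _ => ∅, rfl, rfl, fun _ _ => hc, fun i hi => by omega⟩
  | @tail n c d d' p h hd hp hl hr ih =>
    obtain ⟨A, P, h0, hn, hA, hP⟩ := ih
    refine ⟨fun i => if i ≤ n then A i else d', fun i => if i < n then P i else p, ?_, ?_, ?_, ?_⟩
    · simpa using h0
    · simp
    · intro i hi
      by_cases h : i ≤ n
      · simpa only [if_pos h] using hA i h
      · simpa only [if_neg h] using hd
    · intro i hi
      by_cases h : i < n
      · simpa only [if_pos h, if_pos h.le, if_pos (Nat.succ_le_of_lt h)] using hP i h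
      · obtain rfl : i = n := by omega
        simpa [hn] using ⟨hp, hl, hr⟩

lemma Linked.exists_gallery {n : ℕ} {c d : Set X} (h : B.Linked n c d) {x y : X}
    (hx : B.IsVertex x) (hy : B.IsVertex y) (hxc : x ∈ c) (hyd : y ∈ d) :
    ∃ σ : B.Gallery n, σ.source = x ∧ σ.target = y := by
  obtain ⟨A, P, h0, hn, hA, hP⟩ := h.exists_seq
  exact ⟨{
    source := x
    target := y
    alcove := fun i => A i
    panel := fun i => P i
    isVertex_source := hx
    isVertex_target := hy
    isAlcove := fun i => hA i (Nat.lt_succ_iff.1 i.2)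
    isPanel := fun i => (hP i i.2).1
    source_mem := by simpa [h0] using hxc
    target_mem := by simpa [hn] using hyd
    panel_subset_left := fun i => by simpa using (hP i i.2).2.1
    panel_subset_right := fun i => by simpa using (hP i i.2).2.2 }, rfl, rfl⟩

lemma Gallery.linked {n : ℕ} (σ : B.Gallery n) (a d : ℕ) (hd : a + d < n + 1) :
    B.Linked d (σ.alcove ⟨a, by omega⟩) (σ.alcove ⟨a + d, hd⟩) := by
  induction d with
  | zero => exact .refl (σ.isAlcove _)
  | succ d ih =>
    have hi : a + d < n := by omega
    exact (ih (by omega)).tail (σ.isAlcove _) (σ.isPanel ⟨a + d, hi⟩)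
      (σ.panel_subset_left ⟨a + d, hi⟩) (σ.panel_subset_right ⟨a + d, hi⟩)

/-- A chain of alcoves becomes a competing gallery once the end vertices are added. -/
lemma Gallery.IsMinimal.not_linked {n m : ℕ} {σ : B.Gallery n} (h : σ.IsMinimal) (hm : m < n) :
    ¬ B.Linked m (σ.alcove 0) (σ.alcove (Fin.last n)) := fun hl => by
  obtain ⟨σ', h1, h2⟩ := hl.exists_gallery σ.isVertex_source σ.isVertex_target σ.source_mem
    σ.target_mem
  exact absurd (h m σ' h1 h2) (not_le.2 hm)

lemma linked_of_isStraight {g : V → X} (hg : g ∈ B.charts) {k : ℕ} {e v : ℕ → V}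
    (h : R.IsStraight k e v) (a d : ℕ) (hd : a + d ≤ k) :
    B.Linked d (g '' R.closedFace (e a)) (g '' R.closedFace (e (a + d))) := by
  induction d with
  | zero => exact .refl (isAlcove_image hg (h.1 a hd))
  | succ d ih =>
    obtain ⟨i, l, hw⟩ := h.2 (a + d) hd
    exact (ih (by omega)).tail (isAlcove_image hg (h.1 _ hd)) (isPanel_image hg hw)
      (Set.image_mono (R.closedFace_subset (h.3 (a + d) hd)))
      (Set.image_mono (R.closedFace_subset (h.4 (a + d) hd)))

end Linked

/-! ### Minimal galleries and their types -/

section Straight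

variable {ι V N X : Type*} [AddCommGroup V] [Module ℝ V] [AddCommGroup N] [Module ℝ N]
  {R : RootPairing ι ℝ V N} {B : AffineBuilding R X} [R.IsCrystallographic]

/-- A straight gallery and a further alcove lie in a common apartment. -/
lemma exists_chart_extension {k : ℕ} {e v : ℕ → V} (h : R.IsStraight k e v) {f : V → X}
    (hf : f ∈ B.charts) {p : V} {i : ι} {l : ℤ} (hp : R.IsWallPoint i l p)
    (hpe : p ∈ R.closedFace (e k))
    (hside : ∀ j ≤ k, 0 < (R.ev i (e j) - l) * (R.ev i (e k) - l)) {c : Set X}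
    (hc : B.IsAlcove c) (hpc : f '' R.closedFace p ⊆ c) :
    ∃ g ∈ B.charts, (∀ j ≤ k, ∀ x ∈ R.closedFace (e j), g x = f x) ∧
      ∃ e', R.IsRegularPoint e' ∧ c = g '' R.closedFace e' ∧ p ∈ R.closedFace e' := by
  obtain ⟨x, hx, hcx⟩ := hc.exists_chart
  -- An apartment through the first alcove and an interior point of `c` suffices: `e k` lies in the
  -- hull of `p` and `e 0`, and the intermediate alcoves lie in the hull of `e 0` and `e k`.
  obtain ⟨g₀, hg₀, h0, hxg⟩ := B.common (f (e 0)) x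
  obtain ⟨g, hg, hr, hgf⟩ := exists_chart_agree hf hg₀
  rw [← hr] at h0 hxg hgf
  obtain ⟨e', he', hce', -⟩ := hcx g hg hxg
  have hfp : f p ∈ g '' R.closedFace e' :=
    hce' ▸ hpc (Set.mem_image_of_mem f (R.self_mem_closedFace p))
  have hfpr : f p ∈ Set.range g := Set.image_subset_range _ _ hfp
  have hpe' : p ∈ R.closedFace e' := by
    rw [← hgf p hfpr] at hfp
    exact (B.injective g hg).mem_set_image.1 hfp
  have hek : f (e k) ∈ Set.range g := by
    refine mem_range_of_hull hf hg (S := {p, e 0}) ?_ fun a m ham => ?_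
    · rintro y (rfl | rfl)
      · exact hfpr
      · exact h0
    · by_contra! hlt
      have h1 := R.hyperplane_eq_of_not_mem hp hpe (ham p (by simp)) hlt
      exact absurd (le_ev_of_sameSide h1 (hside 0 k.zero_le) (ham (e 0) (by simp))) (not_le.2 hlt)
  refine ⟨g, hg, fun j hj x hx => hgf x ?_, e', he', hce', hpe'⟩
  refine mem_range_of_closedFace hf hg (mem_range_of_hull hf hg (S := {e k, e 0}) ?_ ?_) hx
  · rintro y (rfl | rfl)
    · exact hek
    · exact h0
  · exact fun a m ham => h.6 a m 0 j k j.zero_le hj le_rfl (ham _ (by simp)) (ham _ (by simp))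

/-- A minimal gallery from vertex to vertex lies in an apartment and is straight there. -/
theorem Gallery.IsMinimal.exists_isStraight {n : ℕ} {τ : B.Gallery n} (hτ : τ.IsMinimal) (k : ℕ)
    (hk : k < n + 1) :
    ∃ h ∈ B.charts, ∃ e v : ℕ → V, R.IsStraight k e v ∧
      (∀ j (hj : j ≤ k), τ.alcove ⟨j, by omega⟩ = h '' R.closedFace (e j)) ∧
      ∀ j (hj : j < k), τ.panel ⟨j, by omega⟩ = h '' R.closedFace (v j) := by
  induction k with
  | zero =>
    obtain ⟨f, hf, _, ⟨e, he, rfl⟩, h⟩ := τ.isAlcove ⟨0, hk⟩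
    refine ⟨f, hf, fun _ => e, fun _ => e, ⟨fun _ _ => he, fun j hj => by omega,
      fun j hj => by omega, fun j hj => by omega, fun j hj => by omega,
      fun i l a c d _ _ _ ha _ => ha⟩, fun j hj => ?_, fun j hj => by omega⟩
    obtain rfl : j = 0 := by omega
    exact h
  | succ k ih =>
    obtain ⟨f, hf, e, v, hs, hA, hP⟩ := ih (by omega)
    have hkn : k < n := by omega
    have hpl : τ.panel ⟨k, hkn⟩ ⊆ τ.alcove ⟨k, by omega⟩ := τ.panel_subset_left ⟨k, hkn⟩
    have hpr : τ.panel ⟨k, hkn⟩ ⊆ τ.alcove ⟨k + 1, hk⟩ := τ.panel_subset_right ⟨k, hkn⟩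
    obtain ⟨p, i, l, hp, hpP⟩ := (τ.isPanel ⟨k, hkn⟩).eq_image hf
      (hpl.trans (hA k le_rfl ▸ Set.image_subset_range _ _))
    have hpe : p ∈ R.closedFace (e k) := by
      rw [hpP, hA k le_rfl] at hpl
      exact (Set.image_subset_image_iff (B.injective f hf)).1 hpl (R.self_mem_closedFace p)
    have hrest : B.Linked (n - (k + 1)) (τ.alcove ⟨k + 1, hk⟩) (τ.alcove (Fin.last n)) := by
      have := τ.linked (k + 1) (n - (k + 1)) (by omega)
      convert this using 2
      ext; simp; omega
    have hne : τ.alcove ⟨k, by omega⟩ ≠ τ.alcove ⟨k + 1, hk⟩ := fun heq => by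
      have h1 := τ.linked 0 k (by omega)
      simp only [zero_add] at h1
      rw [heq] at h1
      exact hτ.not_linked (by omega) (h1.trans hrest)
    -- Otherwise the hyperplane of the next panel was crossed earlier, between some alcoves `j` and
    -- `j + 1`. Reflecting the part from `j + 1` to `k` folds alcove `j + 1` onto alcove `j` and
    -- fixes the next panel, which saves one step.
    have hside : ∀ j ≤ k, 0 < (R.ev i (e j) - l) * (R.ev i (e k) - l) := by
      have hreg : ∀ j ≤ k, R.ev i (e j) - l ≠ 0 := fun j hj => sub_ne_zero.2 (hs.1 j hj i l)
      by_contra! hcon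
      obtain ⟨j₀, hj₀, hcon⟩ := hcon
      obtain ⟨j, hj0, hjk, h1, h2⟩ : ∃ j, j₀ ≤ j ∧ j < k ∧
          (R.ev i (e j) - l) * (R.ev i (e k) - l) ≤ 0 ∧
          0 < (R.ev i (e (j + 1)) - l) * (R.ev i (e k) - l) := by
        by_contra! hall
        have : ∀ j, j₀ ≤ j → j ≤ k → (R.ev i (e j) - l) * (R.ev i (e k) - l) ≤ 0 := by
          intro j hj
          induction j, hj using Nat.le_induction with
          | base => exact fun _ => hcon
          | succ j hj ih => exact fun h => hall j hj h (ih (by omega))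
        exact absurd (this k hj₀ le_rfl) (not_le.2 (mul_self_pos.2 (hreg k le_rfl)))
      have h1 := lt_of_le_of_ne h1 (mul_ne_zero (hreg j hjk.le) (hreg k le_rfl))
      have hneg : (R.ev i (e j) - l) * (R.ev i (e (j + 1)) - l) < 0 := by
        by_contra! h3
        have := mul_self_pos.2 (hreg k le_rfl)
        nlinarith [mul_neg_of_neg_of_pos h1 h2]
      have hvj : R.ev i (v j) = l := by
        rcases mul_neg_iff.1 hneg with ⟨h1, h2⟩ | ⟨h1, h2⟩
        · exact R.ev_eq_of_separated (hs.3 j hjk) (hs.4 j hjk) (by linarith) (by linarith)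
        · exact R.ev_eq_of_separated (hs.4 j hjk) (hs.3 j hjk) (by linarith) (by linarith)
      obtain ⟨i', l', hw⟩ := hs.2 j hjk
      have hw := IsWallPoint.of_mem hw hvj
      set s := R.affineReflection i l with hs_def
      have hsW : s ∈ R.affineWeylGroup := R.affineReflection_mem i l
      have hvs : v j ∈ R.closedFace (s (e (j + 1))) := by
        have := weyl_mem_closedFace hsW (hs.4 j hjk)
        rwa [hs_def, R.affineReflection_eq_self hvj] at this
      have hfold : R.closedFace (e j) = R.closedFace (s (e (j + 1))) := by
        refine R.closedFace_eq_of_sameSide hw (hs.3 j hjk) hvs ?_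
        rw [hs_def, R.ev_affineReflection_self]
        linarith
      have c1 := τ.linked 0 j (by omega)
      simp only [zero_add] at c1
      have c2 := linked_of_isStraight (B.comp_mem f hf s hsW) hs (j + 1) (k - (j + 1)) (by omega)
      rw [Set.image_comp, image_closedFace hsW, ← hfold, ← hA j hjk.le,
        show j + 1 + (k - (j + 1)) = k by omega, Set.image_comp, image_closedFace hsW] at c2
      have hps : p ∈ R.closedFace (s (e k)) := by
        have := weyl_mem_closedFace hsW hpe
        rwa [hs_def, R.affineReflection_eq_self hp.1] at this
      have c3 := (c1.trans c2).tail (τ.isAlcove ⟨k + 1, hk⟩) (τ.isPanel ⟨k, hkn⟩)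
        (hpP ▸ Set.image_mono (R.closedFace_subset hps)) hpr
      exact hτ.not_linked (by omega) (c3.trans hrest)
    obtain ⟨g, hg, hgf, e', he', hce', hpe'⟩ := exists_chart_extension hs hf hp hpe hside
      (τ.isAlcove ⟨k + 1, hk⟩) (hpP ▸ hpr)
    have hgA : ∀ j (hj : j ≤ k), τ.alcove ⟨j, by omega⟩ = g '' R.closedFace (e j) := fun j hj => by
      rw [hA j hj]
      exact Set.image_congr fun x hx => (hgf j hj x hx).symm
    have hs' : R.IsStraight k (fun j => if j ≤ k then e j else e')
        (fun j => if j < k then v j else p) :=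
      hs.congr (fun j hj => if_pos hj) (fun j hj => if_pos hj)
    refine ⟨g, hg, _, _, hs'.succ (i := i) (l := l) ?_ ?_ ?_ ?_ ?_ ?_, ?_, ?_⟩
    · simpa using he'
    · simpa using hp
    · simpa using hpe
    · simpa using hpe'
    · simp only [le_refl, if_true, Nat.not_succ_le_self, if_false]
      intro heq
      apply hne
      rw [hgA k le_rfl, hce', heq]
    · intro j hj
      simp only [le_refl, if_true, if_pos hj]
      exact hside j hj
    · intro j hj
      by_cases hjk : j ≤ k
      · simp only [if_pos hjk]; exact hgA j hjk
      · obtain rfl : j = k + 1 := by omega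
        simp only [if_neg hjk]; exact hce'
    · intro j hj
      by_cases hjk : j < k
      · simp only [if_pos hjk]
        rw [hP j hjk]
        exact Set.image_congr fun x hx =>
          (hgf j hjk.le x (R.closedFace_subset (hs.3 j hjk) hx)).symm
      · obtain rfl : j = k := by omega
        simp only [if_neg hjk]
        rw [hpP]
        exact Set.image_congr fun x hx => (hgf j le_rfl x (R.closedFace_subset hpe hx)).symm

/-- Galleries may be moved from one apartment to another one by a retraction. -/
lemma exists_gallery_retraction {g h : V → X} (hh : h ∈ B.charts) {z : V} {φ : X → V}
    (hφ : B.IsRetractionAt g z φ) {m : ℕ} (σ : B.Gallery m)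
    (hx : B.IsVertex (h (φ σ.source))) (hy : B.IsVertex (h (φ σ.target))) :
    ∃ τ : B.Gallery m, τ.source = h (φ σ.source) ∧ τ.target = h (φ σ.target) := by
  have hmem : ∀ {x : X} {c : Set X}, x ∈ c → h (φ x) ∈ h '' (φ '' c) := fun hx =>
    Set.mem_image_of_mem h (Set.mem_image_of_mem φ hx)
  refine ⟨{
    source := h (φ σ.source)
    target := h (φ σ.target)
    alcove := fun i => h '' (φ '' σ.alcove i)
    panel := fun i => h '' (φ '' σ.panel i)
    isVertex_source := hx
    isVertex_target := hy
    isAlcove := fun i => ?_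
    isPanel := fun i => ?_
    source_mem := hmem σ.source_mem
    target_mem := hmem σ.target_mem
    panel_subset_left := fun i => Set.image_mono (Set.image_mono (σ.panel_subset_left i))
    panel_subset_right := fun i => Set.image_mono (Set.image_mono (σ.panel_subset_right i)) },
    rfl, rfl⟩
  · obtain ⟨f, hf, _, ⟨e, he, rfl⟩, heq⟩ := σ.isAlcove i
    obtain ⟨w, hw, hwv⟩ := hφ.local_weyl f hf e
    rw [heq, Set.image_image φ, Set.image_congr hwv, image_closedFace hw]
    exact isAlcove_image hh (isRegularPoint_weyl hw he)
  · obtain ⟨f, hf, _, hF, heq⟩ := σ.isPanel i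
    obtain ⟨v, a, l, hv, rfl⟩ := R.isPanel_iff.1 hF
    obtain ⟨w, hw, hwv⟩ := hφ.local_weyl f hf v
    obtain ⟨j, l', hjl, -⟩ := weyl_conj_affineReflection (inv_mem hw) a l
    rw [heq, Set.image_image φ, Set.image_congr hwv, image_closedFace hw]
    exact isPanel_image hh (isWallPoint_weyl (inv_mem hw) (by rwa [weyl_inv_apply]) hjl)

variable [Fintype ι] [R.IsRootSystem]

/-- Equal types mean that some Weyl element carries one set to the other; since both lie in one
alcove, a strict fundamental domain, this element fixes the points. -/
lemma image_eq_of_faceType_eq {f g : V → X} (hf : f ∈ B.charts) (hg : g ∈ B.charts) {e : V}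
    (he : R.IsRegularPoint e) {P Q : Set V} (hP : P ⊆ R.closedFace e) (hQ : Q ⊆ R.closedFace e)
    (h : B.faceType (f '' P) = B.faceType (g '' Q)) : P = Q := by
  rw [faceType_image hf, faceType_image hg] at h
  have hPmem : P ∈ {D | ∃ w ∈ R.affineWeylGroup, w '' D = P} := ⟨1, one_mem _, Set.image_id P⟩
  rw [h] at hPmem
  obtain ⟨w, hw, rfl⟩ := hPmem
  have : ∀ x ∈ P, w x = x := fun x hx =>
    weyl_eq_self he hw (hP hx) (hQ (Set.mem_image_of_mem w hx))
  rw [Set.image_congr this, Set.image_id']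

/-- A gallery without folds having the panel types of a straight gallery is a copy of this straight
gallery. -/
theorem exists_chart_of_isStraight {n : ℕ} {σ : B.Gallery n}
    (hσ : ∀ i : Fin n, σ.alcove i.castSucc ≠ σ.alcove i.succ) {e v : ℕ → V}
    (hs : R.IsStraight n e v) {h : V → X} (hh : h ∈ B.charts)
    (ht : ∀ i : Fin n, B.faceType (σ.panel i) = B.faceType (h '' R.closedFace (v i))) (k : ℕ)
    (hk : k < n + 1) :
    ∃ g ∈ B.charts, ∀ j (hj : j ≤ k), σ.alcove ⟨j, by omega⟩ = g '' R.closedFace (e j) := by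
  induction k with
  | zero =>
    obtain ⟨f, hf, _, ⟨e', he', rfl⟩, h⟩ := σ.isAlcove ⟨0, hk⟩
    obtain ⟨w, hw, hwe⟩ := exists_weyl_image_eq he' (hs.1 0 n.zero_le)
    refine ⟨f ∘ w, B.comp_mem f hf w hw, fun j hj => ?_⟩
    obtain rfl : j = 0 := by omega
    rw [Set.image_comp, hwe, h]
  | succ k ih =>
    obtain ⟨f, hf, hA⟩ := ih (by omega)
    have hkn : k < n := by omega
    have hpl : σ.panel ⟨k, hkn⟩ ⊆ σ.alcove ⟨k, by omega⟩ := σ.panel_subset_left ⟨k, hkn⟩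
    have hpr : σ.panel ⟨k, hkn⟩ ⊆ σ.alcove ⟨k + 1, hk⟩ := σ.panel_subset_right ⟨k, hkn⟩
    have hne : σ.alcove ⟨k, by omega⟩ ≠ σ.alcove ⟨k + 1, hk⟩ := hσ ⟨k, hkn⟩
    obtain ⟨p, -, -, -, hpP⟩ := (σ.isPanel ⟨k, hkn⟩).eq_image hf
      (hpl.trans (hA k le_rfl ▸ Set.image_subset_range _ _))
    have hpe : R.closedFace p ⊆ R.closedFace (e k) := by
      rw [hpP, hA k le_rfl] at hpl
      exact (Set.image_subset_image_iff (B.injective f hf)).1 hpl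
    have hpv : R.closedFace p = R.closedFace (v k) :=
      image_eq_of_faceType_eq hf hh (hs.1 k hkn.le) hpe (R.closedFace_subset (hs.3 k hkn))
        (by rw [← hpP]; exact ht ⟨k, hkn⟩)
    obtain ⟨i, l, hw⟩ := hs.2 k hkn
    have hside := (hs.mono (Nat.le_of_lt_succ hk)).sameSide hw
    rw [hpv] at hpP
    obtain ⟨g, hg, hgf, e', he', hce', hve'⟩ := exists_chart_extension (hs.mono hkn.le) hf hw
      (hs.3 k hkn) hside (σ.isAlcove ⟨k + 1, hk⟩) (hpP ▸ hpr)
    have hgA : ∀ j (hj : j ≤ k), σ.alcove ⟨j, by omega⟩ = g '' R.closedFace (e j) := fun j hj => by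
      rw [hA j hj]
      exact Set.image_congr fun x hx => (hgf j hj x hx).symm
    refine ⟨g, hg, fun j hj => ?_⟩
    rcases Nat.le_succ_iff.1 hj with hj | rfl
    · exact hgA j hj
    rw [hce']
    congr 1
    -- Neither gallery folds here, so `e'` and `e (k + 1)` are both across the panel from `e k`;
    -- there is only one alcove there.
    have h1 := mul_neg_of_closedFace_ne (hs.1 k hkn.le) he' hw (hs.3 k hkn) hve'
      (fun heq => hne (by rw [hgA k le_rfl, hce', heq]))
    have h2 := mul_neg_of_closedFace_ne (hs.1 k hkn.le) (hs.1 (k + 1) hkn) hw (hs.3 k hkn)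
      (hs.4 k hkn) (hs.5 k hkn)
    refine R.closedFace_eq_of_sameSide hw hve' (hs.4 k hkn) ?_
    by_contra! hcon
    have := mul_pos_of_neg_of_neg h1 h2
    nlinarith [mul_self_nonneg (R.ev i (e k) - l)]

/-- A gallery without folds that has the type of a minimal gallery is minimal. -/
theorem Gallery.IsMinimal.of_type_eq {n : ℕ} {τ σ : B.Gallery n} (hτ : τ.IsMinimal)
    (hσ : ∀ i : Fin n, σ.alcove i.castSucc ≠ σ.alcove i.succ) (ht : σ.type = τ.type) :
    σ.IsMinimal := by
  obtain ⟨h, hh, e, v, hs, hA, hP⟩ := hτ.exists_isStraight n n.lt_succ_self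
  simp only [Gallery.type, Prod.mk.injEq] at ht
  obtain ⟨ht1, ht2, ht3⟩ := ht
  obtain ⟨g, hg, hgA⟩ := exists_chart_of_isStraight hσ hs hh
    (fun i => by rw [← hP i i.2]; exact congrFun ht2 i) n n.lt_succ_self
  -- A vertex of an alcove is determined by its type, so corresponding ends of `σ` and `τ` have the
  -- same coordinates in `g` and `h`.
  have hends : ∀ j (hj : j ≤ n) (x y : X), x ∈ σ.alcove ⟨j, by omega⟩ →
      y ∈ τ.alcove ⟨j, by omega⟩ → B.faceType {x} = B.faceType {y} → ∃ u, x = g u ∧ y = h u := by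
    intro j hj x y hx hy hxy
    rw [hgA j hj] at hx
    rw [hA j hj] at hy
    obtain ⟨a, ha, rfl⟩ := hx
    obtain ⟨c, hc, rfl⟩ := hy
    rw [← Set.image_singleton, ← Set.image_singleton] at hxy
    have := image_eq_of_faceType_eq hg hh (hs.1 j hj) (Set.singleton_subset_iff.2 ha)
      (Set.singleton_subset_iff.2 hc) hxy
    exact ⟨a, rfl, by rw [Set.singleton_injective this]⟩
  obtain ⟨x, hx, hx'⟩ := hends 0 n.zero_le _ _ σ.source_mem τ.source_mem ht1
  obtain ⟨y, hy, hy'⟩ := hends n le_rfl _ _ σ.target_mem τ.target_mem ht3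
  -- A competitor of `σ` is retracted onto the apartment of `g` and transported by `h`; the result
  -- has the ends of `τ` and the same length.
  obtain ⟨φ, hφ⟩ := B.exists_isRetractionAt hg (hs.1 0 n.zero_le)
  intro m σ' h1 h2
  have e1 : h (φ σ'.source) = τ.source := by
    rw [h1, hx, hφ.apply_chart g hg fun _ _ => rfl, hx']
  have e2 : h (φ σ'.target) = τ.target := by
    rw [h2, hy, hφ.apply_chart g hg fun _ _ => rfl, hy']
  obtain ⟨τ', h1', h2'⟩ := exists_gallery_retraction hh hφ σ' (e1 ▸ τ.isVertex_source)
    (e2 ▸ τ.isVertex_target)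
  exact hτ m τ' (h1'.trans e1) (h2'.trans e2)

end Straight

end AffineBuilding

theorem propositionB {ι V N X : Type*} [Fintype ι]
    [AddCommGroup V] [Module ℝ V] [AddCommGroup N] [Module ℝ N]
    (R : RootPairing ι ℝ V N) [R.IsRootSystem] [R.IsCrystallographic] [R.IsIrreducible]
    (B : AffineBuilding R X) (hB : B.IsThick)
    -- the apartment `A = range f`, the origin `f o`, and the fundamental Weyl chamber
    -- `f '' weylChamber b o`
    (f : V → X) (hf : f ∈ B.charts) (o : V) (ho : R.IsSpecial o) (b : R.Base)
    (ρ : X → X) (hρ : B.IsOppRetraction f b o ρ)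
    {n : ℕ} (γ : B.Gallery n) (hγA : γ.IsIn f) (hγ₀ : γ.source = f o)
    (hγ : γ.IsPositivelyFolded f (RootPairing.oppWeylChamber b o))
    -- the type of `γ` is the type of some minimal gallery with source `f o`
    (hγt : ∃ τ : B.Gallery n, τ.source = f o ∧ τ.IsMinimal ∧ τ.type = γ.type) :
    ∃ σ : B.Gallery n, σ.source = f o ∧ σ.IsMinimal ∧ σ.type = γ.type ∧
      AffineBuilding.Gallery.MapsTo ρ σ γ := by
  obtain ⟨τ, -, hτ, hτt⟩ := hγt
  obtain ⟨σ, hσ₀, hσt, hσγ, hσ⟩ := AffineBuilding.exists_unfolding hB hf hρ γ hγA hγ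
  exact ⟨σ, hσ₀.trans hγ₀, hτ.of_type_eq hσ (hσt.trans hτt.symm), hσt, hσγ⟩
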